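/- Let $k$ be a commutative ring and $A$ a unital associative $k$-algebra; $\otimes=\otimes_k$. Let $\Delta S$ be the category with objects $[n]=\{0,\dots,n\}$, $n\ge 0$, whose morphisms $[n]\to[m]$ are the maps of sets together with a total ordering of each fibre. Such a morphism is written in tensor notation as $X_0\otimes\cdots\otimes X_m$, where the $X_j$ are monomials in the non-commuting variables $x_0,\dots,x_n$, each variable occurring exactly once in total ($X_j$ lists the fibre over $j$ in order, the empty monomial being $1$); composition is substitution of monomials. Let $B^{sym}_*A:\Delta S\to k\text{-}\mathrm{Mod}$ be the functor $[n]\mapsto A^{\otimes(n+1)}$ on which a morphism acts by substituting $a_i$ for $x_i$ and multiplying out. For a contravariant functor $M$ and a covariant functor $N$ from $\Delta S$ to $k$-modules, let $M\otimes_{\Delta S}N=\bigoplus_n M([n])\otimes N([n])\,/\,\big(y\otimes f_*(x)\approx f^*(y)\otimes x\big)$, let $\mathrm{Tor}^{\Delta S}_i(-,N)$ be the left derived functors of $-\otimes_{\Delta S}N$ on $\Delta S^{\mathrm{op}}$-modules, let $\underline{k}$ be the constant $\Delta S^{\mathrm{op}}$-module with value $k$, and let $HS_i(A)=\mathrm{Tor}_i^{\Delta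 S}(\underline{k},B^{sym}_*A)$ be the symmetric homology of $A$. **Theorem.** (1) The sequence of $\Delta S^{\mathrm{op}}$-modules $$0\leftarrow \underline{k}\xleftarrow{\ \epsilon\ }k[\mathrm{Mor}_{\Delta S}(-,[0])]\xleftarrow{\ \rho\ }k[\mathrm{Mor}_{\Delta S}(-,[2])]\xleftarrow{(\alpha,\beta)}k[\mathrm{Mor}_{\Delta S}(-,[3])]\oplus k[\mathrm{Mor}_{\Delta S}(-,[0])]$$ is exact, and all its terms other than $\underline{k}$ are projective. Here $\epsilon(\phi)=1$, $\rho(\psi)=(x_0x_1x_2)\circ\psi-(x_2x_1x_0)\circ\psi$, and $\alpha$, $\beta$ are composition on the left with $x_0x_1\otimes x_2\otimes x_3+x_3\otimes x_2x_0\otimes x_1+x_1x_2x_0\otimes1\otimes x_3+x_3\otimes x_1x_2\otimes x_0$ and with $1\otimes x_0\otimes 1$, respectively. (2) There are $k$-linear maps $$0\longleftarrow A\xleftarrow{\ \partial_1\ }A^{\otimes 3}\xleftarrow{\ \partial_2\ }A^{\otimes4}\oplus A,$$ given by $\partial_1(a\otimes b\otimes c)=abc-cba$, $\partial_2(a\otimes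 b\otimes c\otimes d)=ab\otimes c\otimes d+d\otimes ca\otimes b+bca\otimes1\otimes d+d\otimes bc\otimes a$ and $\partial_2(a)=1\otimes a\otimes1$. They satisfy $\partial_1\partial_2=0$, and there are isomorphisms of $k$-modules $HS_0(A)\cong A/\operatorname{im}\partial_1$ and $HS_1(A)\cong\ker\partial_1/\operatorname{im}\partial_2$. (3) The complex in (2) is isomorphic to the one obtained from the last three terms of (1) by applying $-\otimes_{\Delta S}B^{sym}_*A$. The isomorphism is given by the evaluation maps $k[\mathrm{Mor}_{\Delta S}(-,[p])]\otimes_{\Delta S}B^{sym}_*A\to A^{\otimes(p+1)}$, $\phi\otimes y\mapsto\phi_*(y)$, for $p=0,2,3$. -/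

import Mathlib

open CategoryTheory CategoryTheory.Limits Opposite TensorProduct

universe u

noncomputable section

namespace SymmetricHomology

/-! ## Modules over a small category and their tensor product -/

section CModules

/-- The category of `C`-modules, i.e. covariant functors from `C` to `k`-modules. -/
abbrev CMod (k : Type u) [CommRing k] (C : Type) [SmallCategory.{0} C] : Type (u + 1) :=
  C ⥤ ModuleCat.{u} k

/-- The category of `Cᵒᵖ`-modules, i.e. contravariant functors from `C` to `k`-modules. -/
abbrev COpMod (k : Type u) [CommRing k] (C : Type) [SmallCategory.{0} C] : Type (u + 1) :=
  Cᵒᵖ ⥤ ModuleCat.{u} k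

/-- The trivial `Cᵒᵖ`-module: every object goes to `k`, every morphism to `id`. -/
def trivialOp (k : Type u) [CommRing k] (C : Type) [SmallCategory.{0} C] : COpMod k C :=
  (Functor.const Cᵒᵖ).obj (ModuleCat.of k k)

/-- The `Cᵒᵖ`-module `k[Mor_C(-, Y)]`: free modules on Hom-sets, acted on by precomposition. -/
def freeOp (k : Type u) [CommRing k] {C : Type} [SmallCategory.{0} C] (Y : C) : COpMod k C where
  obj X := ModuleCat.of k ((X.unop ⟶ Y) →₀ k)
  map g := ModuleCat.ofHom (Finsupp.lmapDomain k k (fun φ => g.unop ≫ φ))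
  map_id X := by
    ext φ : 3
    simp
  map_comp f g := by
    ext φ : 3
    simp

/-- Postcomposition with `f : Y ⟶ Z` as a map `k[Mor_C(-, Y)] ⟶ k[Mor_C(-, Z)]`. -/
def freeOpMap (k : Type u) [CommRing k] {C : Type} [SmallCategory.{0} C] {Y Z : C} (f : Y ⟶ Z) :
    freeOp k Y ⟶ freeOp k Z where
  app X := ModuleCat.ofHom (Finsupp.lmapDomain k k (fun φ => φ ≫ f))
  naturality X X' g := by
    refine ModuleCat.hom_ext (Finsupp.lhom_ext' fun φ => LinearMap.ext_ring ?_)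
    change Finsupp.mapDomain _ (Finsupp.mapDomain _ (Finsupp.single φ (1 : k))) =
      Finsupp.mapDomain _ (Finsupp.mapDomain _ (Finsupp.single φ (1 : k)))
    simp

/-- The augmentation `k[Mor_C(-, Y)] ⟶ k`, sending every morphism to `1`. -/
def augmentation (k : Type u) [CommRing k] {C : Type} [SmallCategory.{0} C] (Y : C) :
    freeOp k Y ⟶ trivialOp k C where
  app X := ModuleCat.ofHom (Finsupp.lsum k (fun _ => LinearMap.id))
  naturality X X' g := by
    refine ModuleCat.hom_ext (Finsupp.lhom_ext' fun φ => LinearMap.ext_ring ?_)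
    change Finsupp.lsum k (fun _ => LinearMap.id)
      (Finsupp.mapDomain _ (Finsupp.single φ (1 : k))) =
        Finsupp.lsum k (fun _ => LinearMap.id) (Finsupp.single φ (1 : k))
    simp

/-- The map `k[Mor_C(-, Y)] ⟶ F` determined by an element of `F(Y)`. -/
def freeOpDesc (k : Type u) [CommRing k] {C : Type} [SmallCategory.{0} C] {Y : C}
    (F : COpMod k C) (x : F.obj (op Y)) : freeOp k Y ⟶ F where
  app X := ModuleCat.ofHom
    (Finsupp.lsum k (fun φ : X.unop ⟶ Y => LinearMap.toSpanSingleton k _ ((F.map φ.op).hom x)))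
  naturality X X' g := by
    refine ModuleCat.hom_ext (Finsupp.lhom_ext' fun φ => LinearMap.ext_ring ?_)
    change Finsupp.lsum k
        (fun φ : X'.unop ⟶ Y => LinearMap.toSpanSingleton k _ ((F.map φ.op).hom x))
        (Finsupp.mapDomain (fun φ => g.unop ≫ φ) (Finsupp.single φ (1 : k))) =
      (F.map g).hom (Finsupp.lsum k
        (fun φ : X.unop ⟶ Y => LinearMap.toSpanSingleton k _ ((F.map φ.op).hom x))
        (Finsupp.single φ (1 : k)))
    rw [Finsupp.mapDomain_single, Finsupp.lsum_single, Finsupp.lsum_single]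
    simp

lemma freeOpDesc_id (k : Type u) [CommRing k] {C : Type} [SmallCategory.{0} C] {Y : C}
    (F : COpMod k C) (x : F.obj (op Y)) :
    ((freeOpDesc k F x).app (op Y)).hom (Finsupp.single (𝟙 Y) 1) = x := by
  change Finsupp.lsum k
    (fun φ : Y ⟶ Y => LinearMap.toSpanSingleton k _ ((F.map φ.op).hom x))
    (Finsupp.single (𝟙 Y) (1 : k)) = x
  rw [Finsupp.lsum_single]
  simp

lemma freeOp_hom_ext (k : Type u) [CommRing k] {C : Type} [SmallCategory.{0} C] {Y : C}
    {F : COpMod k C} {f g : freeOp k Y ⟶ F}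
    (h : (f.app (op Y)).hom (Finsupp.single (𝟙 Y) 1) =
      (g.app (op Y)).hom (Finsupp.single (𝟙 Y) 1)) : f = g := by
  ext X : 2
  refine ModuleCat.hom_ext (Finsupp.lhom_ext' fun φ => LinearMap.ext_ring ?_)
  have key : ∀ f : freeOp k Y ⟶ F, (f.app X).hom (Finsupp.single φ 1) =
      (F.map φ.op).hom ((f.app (op Y)).hom (Finsupp.single (𝟙 Y) 1)) := by
    intro f
    have := congrArg (fun m => m.hom (Finsupp.single (𝟙 Y) (1 : k))) (f.naturality φ.op)
    change (f.app X).hom (Finsupp.mapDomain (fun ψ => φ ≫ ψ) (Finsupp.single (𝟙 Y) (1 : k))) =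
      (F.map φ.op).hom ((f.app (op Y)).hom (Finsupp.single (𝟙 Y) 1)) at this
    rwa [Finsupp.mapDomain_single, Category.comp_id] at this
  exact (key f).trans ((congrArg (F.map φ.op).hom h).trans (key g).symm)

lemma freeOp_projective (k : Type u) [CommRing k] {C : Type} [SmallCategory.{0} C] (Y : C) :
    Projective (freeOp k Y) := by
  refine ⟨fun {E X} f e he => ?_⟩
  have hs : Function.Surjective (e.app (op Y)) :=
    (ModuleCat.epi_iff_surjective _).1 inferInstance
  obtain ⟨y, hy⟩ := hs ((f.app (op Y)).hom (Finsupp.single (𝟙 Y) 1))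
  refine ⟨freeOpDesc k E y, freeOp_hom_ext k ?_⟩
  rw [← hy]
  exact congrArg (e.app (op Y)).hom (freeOpDesc_id k E y)

instance enoughProjectives_COpMod (k : Type u) [CommRing k] (C : Type) [SmallCategory.{0} C] :
    EnoughProjectives (COpMod k C) where
  presentation F := by
    have (p : Σ Y : C, F.obj (op Y)) : Projective (freeOp k p.1) := freeOp_projective k p.1
    refine ⟨{ p := ∐ fun p : Σ Y : C, F.obj (op Y) => freeOp k p.1
              projective := inferInstance
              f := Sigma.desc fun p => freeOpDesc k F p.2
              epi := ?_ }⟩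
    refine (NatTrans.epi_iff_epi_app _).2 fun X => (ModuleCat.epi_iff_surjective _).2 fun x => ?_
    refine ⟨((Sigma.ι (fun p : Σ Y : C, F.obj (op Y) => freeOp k p.1) ⟨X.unop, x⟩).app X).hom
      (Finsupp.single (𝟙 X.unop) 1), ?_⟩
    have h := Sigma.ι_desc (fun p : Σ Y : C, F.obj (op Y) => freeOpDesc k F p.2) ⟨X.unop, x⟩
    have h2 := congrArg (fun t => (t.app X).hom (Finsupp.single (𝟙 X.unop) (1 : k))) h
    exact h2.trans (freeOpDesc_id k F x)

/-- The relations `y ⊗ f_*(x) ≈ f^*(y) ⊗ x`, for `f : X ⟶ Y`, `x ∈ N(X)`, `y ∈ M(Y)`. -/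
def tensorRel (k : Type u) [CommRing k] {C : Type} [SmallCategory.{0} C] [DecidableEq C]
    (M : COpMod k C) (N : CMod k C) :
    Submodule k (DirectSum C fun X => M.obj (op X) ⊗[k] N.obj X) :=
  Submodule.span k {z | ∃ (X Y : C) (f : X ⟶ Y) (x : N.obj X) (y : M.obj (op Y)),
    z = DirectSum.lof k C (fun X => M.obj (op X) ⊗[k] N.obj X) Y (y ⊗ₜ[k] (N.map f).hom x) -
      DirectSum.lof k C (fun X => M.obj (op X) ⊗[k] N.obj X) X ((M.map f.op).hom y ⊗ₜ[k] x)}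

/-- The tensor product `M ⊗_C N` of a `Cᵒᵖ`-module and a `C`-module. -/
abbrev catTensor (k : Type u) [CommRing k] {C : Type} [SmallCategory.{0} C] [DecidableEq C]
    (M : COpMod k C) (N : CMod k C) : Type u :=
  (DirectSum C fun X => M.obj (op X) ⊗[k] N.obj X) ⧸ tensorRel k M N

/-- The class of `y ⊗ x` in `M ⊗_C N`, for `y ∈ M(X)` and `x ∈ N(X)`. -/
def catTensor.mk (k : Type u) [CommRing k] {C : Type} [SmallCategory.{0} C] [DecidableEq C]
    (M : COpMod k C) (N : CMod k C) (X : C) (y : M.obj (op X)) (x : N.obj X) :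
    catTensor k M N :=
  (tensorRel k M N).mkQ
    (DirectSum.lof k C (fun X => M.obj (op X) ⊗[k] N.obj X) X (y ⊗ₜ[k] x))

/-- The map `M ⊗_C N → M' ⊗_C N` induced by `η : M ⟶ M'`, namely `y ⊗ x ↦ η(y) ⊗ x`. -/
def catTensor.map (k : Type u) [CommRing k] {C : Type} [SmallCategory.{0} C] [DecidableEq C]
    {M M' : COpMod k C} (η : M ⟶ M') (N : CMod k C) : catTensor k M N →ₗ[k] catTensor k M' N :=
  Submodule.mapQ _ _
    (DirectSum.lmap fun X => LinearMap.rTensor (N.obj X) (η.app (op X)).hom) (by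
      rw [tensorRel, Submodule.span_le]
      rintro _ ⟨X, Y, f, x, y, rfl⟩
      refine Submodule.subset_span ⟨X, Y, f, x, (η.app (op Y)).hom y, ?_⟩
      have h := congrArg (fun t => t.hom y) (η.naturality f.op)
      simp only [ModuleCat.hom_comp, LinearMap.comp_apply] at h
      simp [DirectSum.lmap_lof, h])

lemma catTensor.map_mk (k : Type u) [CommRing k] {C : Type} [SmallCategory.{0} C] [DecidableEq C]
    {M M' : COpMod k C} (η : M ⟶ M') (N : CMod k C) (X : C) (y : M.obj (op X)) (x : N.obj X) :
    catTensor.map k η N (catTensor.mk k M N X y x) =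
      catTensor.mk k M' N X ((η.app (op X)).hom y) x := by
  simp [catTensor.map, catTensor.mk, DirectSum.lmap_lof]

lemma catTensor.hom_ext (k : Type u) [CommRing k] {C : Type} [SmallCategory.{0} C]
    [DecidableEq C] {M : COpMod k C} {N : CMod k C} {P : Type u} [AddCommGroup P] [Module k P]
    {f g : catTensor k M N →ₗ[k] P}
    (h : ∀ X y x, f (catTensor.mk k M N X y x) = g (catTensor.mk k M N X y x)) : f = g := by
  refine Submodule.linearMap_qext _ (DirectSum.linearMap_ext k fun X => ?_)
  exact TensorProduct.ext' fun y x => h X y x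

/-- The functor `- ⊗_C N` from `Cᵒᵖ`-modules to `k`-modules. -/
def tensorFunctor (k : Type u) [CommRing k] {C : Type} [SmallCategory.{0} C] [DecidableEq C]
    (N : CMod k C) : COpMod k C ⥤ ModuleCat.{u} k where
  obj M := ModuleCat.of k (catTensor k M N)
  map η := ModuleCat.ofHom (catTensor.map k η N)
  map_id M := by
    refine ModuleCat.hom_ext (catTensor.hom_ext k fun X y x => ?_)
    simp [catTensor.map_mk]
  map_comp η θ := by
    refine ModuleCat.hom_ext (catTensor.hom_ext k fun X y x => ?_)
    simp [catTensor.map_mk]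

instance tensorFunctor_additive (k : Type u) [CommRing k] {C : Type} [SmallCategory.{0} C]
    [DecidableEq C] (N : CMod k C) : (tensorFunctor k N).Additive where
  map_add {M M' η θ} := by
    refine ModuleCat.hom_ext (catTensor.hom_ext k fun X y x => ?_)
    change catTensor.map k (η + θ) N _ = catTensor.map k η N _ + catTensor.map k θ N _
    simp only [catTensor.map_mk]
    simp [catTensor.mk, TensorProduct.add_tmul]

/-- `Tor_i^C(M, N)`: the left derived functors of `- ⊗_C N`, evaluated at `M`. -/
def catTor (k : Type u) [CommRing k] {C : Type} [SmallCategory.{0} C] [DecidableEq C] (i : ℕ)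
    (M : COpMod k C) (N : CMod k C) : ModuleCat.{u} k :=
  ((tensorFunctor k N).leftDerived i).obj M

end CModules

/-! ## The category `ΔS` -/

/-- Objects of `ΔS`: the object `⟨n⟩` is the set `[n] = {0, 1, …, n}`. -/
@[ext]
structure DeltaS where
  n : ℕ
  deriving DecidableEq

/-- Morphisms `[n] → [m]` of `ΔS`, in tensor notation `X_0 ⊗ X_1 ⊗ ⋯ ⊗ X_m`: each `X_j` is a
monomial (a list) in the variables `x_0, …, x_n` and each variable occurs exactly once overall.
Such a datum is a map of sets `f : [n] → [m]` (`f i = j` when `x_i` occurs in `X_j`) with a total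
ordering of each fibre `f⁻¹(j)` (the order of the variables in `X_j`); concatenating the `X_j`
gives the total ordering `x_{g(0)} x_{g(1)} ⋯ x_{g(n)}` of `[n]`, and the lengths of the `X_j` are
the sizes of the fibres of the non-decreasing map `φ` of the pair `(φ, g)`. -/
@[ext]
structure DeltaS.Hom (X Y : DeltaS) where
  word : Fin (Y.n + 1) → List (Fin (X.n + 1))
  once : ∀ i, ∑ j, (word j).count i = 1

lemma DeltaS.sum_count_flatMap {n m p : ℕ} (β : Fin n → List (Fin m)) (α : Fin p → List (Fin n))
    (i : Fin m) (hα : ∀ l, ∑ j, (α j).count l = 1) (hβ : ∑ l, (β l).count i = 1) :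
    ∑ j, ((α j).flatMap β).count i = 1 := by
  have h : ∀ j, ((α j).flatMap β).count i = ∑ l, (α j).count l * (β l).count i := by
    intro j
    rw [List.count_flatMap, Finset.sum_list_map_count]
    simp only [smul_eq_mul, Function.comp]
    refine Finset.sum_subset (Finset.subset_univ _) fun l _ hl => ?_
    rw [List.mem_toFinset] at hl
    simp [List.count_eq_zero_of_not_mem hl]
  simp_rw [h]
  rw [Finset.sum_comm]
  simp_rw [← Finset.sum_mul, hα, one_mul, hβ]

/-- Composition is substitution of monomials for variables. -/
instance : SmallCategory.{0} DeltaS where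
  Hom := DeltaS.Hom
  id X := ⟨fun i => [i], fun i => by simp [List.count_singleton]⟩
  comp β α := ⟨fun j => (α.word j).flatMap β.word,
    fun i => DeltaS.sum_count_flatMap β.word α.word i α.once (β.once i)⟩
  id_comp α := DeltaS.Hom.ext (by funext j; simp)
  comp_id α := DeltaS.Hom.ext (by funext j; simp)
  assoc γ β α := DeltaS.Hom.ext (by funext j; simp [List.flatMap_assoc])

/-- The underlying words of a morphism of `ΔS`. -/
def DeltaS.words {X Y : DeltaS} (α : X ⟶ Y) : Fin (Y.n + 1) → List (Fin (X.n + 1)) :=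
  DeltaS.Hom.word α

/-- A morphism of `ΔS` from its tensor notation. -/
def DeltaS.ofWords {n m : ℕ} (w : Fin (m + 1) → List (Fin (n + 1)))
    (h : ∀ i, ∑ j, (w j).count i = 1) : (⟨n⟩ : DeltaS) ⟶ ⟨m⟩ :=
  DeltaS.Hom.mk w h

/-! ## The symmetric bar construction and symmetric homology -/

section Bar

lemma DeltaS.prod_update {n : ℕ} {A : Type u} [Ring A] (a : Fin n → A)
    (i : Fin n) (l : List (Fin n)) (h : i ∉ l) (x : A) :
    l.map (Function.update a i x) = l.map a :=
  List.map_congr_left fun j hj => Function.update_of_ne (by rintro rfl; exact h hj) _ _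

lemma DeltaS.exists_split {X Y : DeltaS} (α : X ⟶ Y) (i : Fin (X.n + 1)) :
    ∃ (j : Fin (Y.n + 1)) (s t : List (Fin (X.n + 1))), DeltaS.words α j = s ++ i :: t ∧
      i ∉ s ∧ i ∉ t ∧ ∀ j', j' ≠ j → i ∉ DeltaS.words α j' := by
  have h := DeltaS.Hom.once α i
  obtain ⟨j, -, hj⟩ : ∃ j ∈ Finset.univ, (DeltaS.words α j).count i ≠ 0 := by
    by_contra! hc
    exact absurd (h.symm.trans (Finset.sum_eq_zero hc)) one_ne_zero
  rw [← Finset.add_sum_erase _ _ (Finset.mem_univ j)] at h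
  change (DeltaS.words α j).count i + _ = 1 at h
  have h1 : (DeltaS.words α j).count i = 1 := by omega
  have h0 := Finset.sum_eq_zero_iff.1 (show ∑ j ∈ Finset.univ.erase j,
    (DeltaS.words α j).count i = 0 from by unfold DeltaS.words at h1 ⊢; unfold DeltaS.words at h; omega)
  have hm : i ∈ DeltaS.words α j := List.count_pos_iff.1 (by omega)
  obtain ⟨s, t, hst⟩ := List.append_of_mem hm
  rw [hst, List.count_append, List.count_cons_self] at h1
  refine ⟨j, s, t, hst, List.count_eq_zero.1 (by omega), List.count_eq_zero.1 (by omega),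
    fun j' hj' => List.count_eq_zero.1 (h0 j' (by simp [hj']))⟩

/-- The multilinear map `(a_0, …, a_n) ↦ α(a_0, …, a_n)`: substitute `a_i` for `x_i` in the tensor
notation of `α` and multiply out in `A` (the empty monomial gives `1`). -/
def barMultilinear (k : Type u) [CommRing k] (A : Type u) [Ring A] [Algebra k A]
    {X Y : DeltaS} (α : X ⟶ Y) :
    MultilinearMap k (fun _ : Fin (X.n + 1) => A) (⨂[k]^(Y.n + 1) A) where
  toFun a := PiTensorProduct.tprod k fun j => ((DeltaS.words α j).map a).prod
  map_update_add' {dec} a i x y := by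
    obtain rfl : dec = instDecidableEqFin _ := Subsingleton.elim _ _
    obtain ⟨j, s, t, hj, hs, ht, hne⟩ := DeltaS.exists_split α i
    have key : ∀ z : A, (fun j' => ((DeltaS.words α j').map (Function.update a i z)).prod) =
        Function.update (fun j' => ((DeltaS.words α j').map a).prod) j
          ((s.map a).prod * (z * (t.map a).prod)) := by
      intro z
      funext j'
      by_cases h : j' = j
      · subst h
        simp [hj, DeltaS.prod_update a i s hs, DeltaS.prod_update a i t ht]
      · rw [Function.update_of_ne h, DeltaS.prod_update a i _ (hne j' h)]
    simp only [key, add_mul, mul_add, MultilinearMap.map_update_add]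
  map_update_smul' {dec} a i c x := by
    obtain rfl : dec = instDecidableEqFin _ := Subsingleton.elim _ _
    obtain ⟨j, s, t, hj, hs, ht, hne⟩ := DeltaS.exists_split α i
    have key : ∀ z : A, (fun j' => ((DeltaS.words α j').map (Function.update a i z)).prod) =
        Function.update (fun j' => ((DeltaS.words α j').map a).prod) j
          ((s.map a).prod * (z * (t.map a).prod)) := by
      intro z
      funext j'
      by_cases h : j' = j
      · subst h
        simp [hj, DeltaS.prod_update a i s hs, DeltaS.prod_update a i t ht]
      · rw [Function.update_of_ne h, DeltaS.prod_update a i _ (hne j' h)]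
    simp only [key, smul_mul_assoc, mul_smul_comm, MultilinearMap.map_update_smul]

/-- The symmetric bar construction `B^sym A : ΔS ⥤ k-Mod`, `[n] ↦ A^{⊗(n+1)}`. -/
def symBar (k : Type u) [CommRing k] (A : Type u) [Ring A] [Algebra k A] : CMod k DeltaS where
  obj X := ModuleCat.of k (⨂[k]^(X.n + 1) A)
  map α := ModuleCat.ofHom (PiTensorProduct.lift (barMultilinear k A α))
  map_id X := by
    refine ModuleCat.hom_ext (PiTensorProduct.ext (MultilinearMap.ext fun a => ?_))
    simp only [ModuleCat.hom_ofHom, LinearMap.compMultilinearMap_apply, PiTensorProduct.lift.tprod]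
    change PiTensorProduct.tprod k (fun j => (([j] : List (Fin (X.n + 1))).map a).prod) = _
    simp
  map_comp β α := by
    refine ModuleCat.hom_ext (PiTensorProduct.ext (MultilinearMap.ext fun a => ?_))
    simp only [ModuleCat.hom_ofHom, ModuleCat.hom_comp, LinearMap.comp_apply,
      LinearMap.compMultilinearMap_apply, PiTensorProduct.lift.tprod]
    change PiTensorProduct.tprod k
      (fun j => (((DeltaS.words α j).flatMap (DeltaS.words β)).map a).prod) =
        PiTensorProduct.lift (barMultilinear k A α)
          (PiTensorProduct.tprod k fun j => ((DeltaS.words β j).map a).prod)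
    rw [PiTensorProduct.lift.tprod]
    change _ = PiTensorProduct.tprod k
      (fun j => ((DeltaS.words α j).map fun l => ((DeltaS.words β l).map a).prod).prod)
    congr 1
    funext j
    induction DeltaS.words α j with
    | nil => simp
    | cons x l ih => simp [ih]

/-- Symmetric homology `HS_i(A) = Tor_i^{ΔS}(k, B^sym A)`. -/
def HS (k : Type u) [CommRing k] (A : Type u) [Ring A] [Algebra k A] (i : ℕ) : ModuleCat.{u} k :=
  catTor k i (trivialOp k DeltaS) (symBar k A)

end Bar

/-! ## The maps of the partial resolution -/

section Resolution

/-- The homology `ker g / im f` of `M --f--> N --g--> P` (used when `g ∘ f = 0`). -/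
abbrev homologyAt {k : Type u} [CommRing k] {M N P : Type u} [AddCommGroup M] [AddCommGroup N]
    [AddCommGroup P] [Module k M] [Module k N] [Module k P] (f : M →ₗ[k] N) (g : N →ₗ[k] P) :
    Type u :=
  LinearMap.ker g ⧸ (LinearMap.range f).submoduleOf (LinearMap.ker g)

/-- The object `[n]` of `ΔS`. -/
abbrev obj (n : ℕ) : DeltaS := ⟨n⟩

/-- `ρ : k[Mor(-,[2])] ⟶ k[Mor(-,[0])]`, `ψ ↦ (x₀x₁x₂) ∘ ψ - (x₂x₁x₀) ∘ ψ`. -/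
def rho (k : Type u) [CommRing k] : freeOp k (obj 2) ⟶ freeOp k (obj 0) :=
  freeOpMap k (DeltaS.ofWords ![[0, 1, 2]] (by decide)) -
    freeOpMap k (DeltaS.ofWords ![[2, 1, 0]] (by decide))

/-- `α : k[Mor(-,[3])] ⟶ k[Mor(-,[2])]`, postcomposition with
`x₀x₁ ⊗ x₂ ⊗ x₃ + x₃ ⊗ x₂x₀ ⊗ x₁ + x₁x₂x₀ ⊗ 1 ⊗ x₃ + x₃ ⊗ x₁x₂ ⊗ x₀`. -/
def alpha (k : Type u) [CommRing k] : freeOp k (obj 3) ⟶ freeOp k (obj 2) :=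
  freeOpMap k (DeltaS.ofWords ![[0, 1], [2], [3]] (by decide)) +
    freeOpMap k (DeltaS.ofWords ![[3], [2, 0], [1]] (by decide)) +
    freeOpMap k (DeltaS.ofWords ![[1, 2, 0], [], [3]] (by decide)) +
    freeOpMap k (DeltaS.ofWords ![[3], [1, 2], [0]] (by decide))

/-- `β : k[Mor(-,[0])] ⟶ k[Mor(-,[2])]`, postcomposition with `1 ⊗ x₀ ⊗ 1`. -/
def beta (k : Type u) [CommRing k] : freeOp k (obj 0) ⟶ freeOp k (obj 2) :=
  freeOpMap k (DeltaS.ofWords ![[], [0], []] (by decide))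

/-- The value in `A` of the `j`-th monomial of `φ` at `(a_0, …, a_n)`. -/
def evalWord {A : Type u} [Ring A] {X Y : DeltaS} (φ : X ⟶ Y) (a : Fin (X.n + 1) → A)
    (j : Fin (Y.n + 1)) : A :=
  ((DeltaS.words φ j).map a).prod

/-- The class of `φ ⊗ (a_0 ⊗ ⋯ ⊗ a_n)` in `k[Mor(-, Y)] ⊗_{ΔS} B^sym A`, for `φ : [n] → Y`. -/
def gen (k : Type u) [CommRing k] {A : Type u} [Ring A] [Algebra k A] {X Y : DeltaS} (φ : X ⟶ Y)
    (a : Fin (X.n + 1) → A) : (tensorFunctor k (symBar k A)).obj (freeOp k Y) :=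
  catTensor.mk k (freeOp k Y) (symBar k A) X (Finsupp.single φ 1)
    (PiTensorProduct.tprod k a : ⨂[k]^(X.n + 1) A)

end Resolution

end SymmetricHomology

end

/-! At the object [n], everything is about words in which each of x_0, …, x_n occurs exactly once.
The module k[Mor(-,[0])] is free on such words, k[Mor(-,[2])] is free on words cut into three
blocks, and a cut word XYZ is read as an edge XYZ → ZYX of a graph on words. Then `rho` sends an
edge to its source minus its target, so exactness has a graph-theoretic meaning.

At k[Mor(-,[0])] it says that the graph is connected: an adjacent transposition is a composite of
three block swaps (`eq_of_perm_of_block_swap`, `rho_exact`). At k[Mor(-,[2])] it says that every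
cycle is a combination of the relations given by `alpha` and `beta`. This is proved with a
potential. Let T be the class of an edge modulo the image of (`alpha`, `beta`). If T(X,Y,Z) = Φ(XYZ)
- Φ(ZYX) for a function Φ on words, then the quotient map factors through `rho`, and hence ker `rho`
lies in the image (`desc_exact`).

To build Φ, fix a letter o and rotate every word until o stands in front. Block swaps then become
swaps of adjacent blocks in the remaining word, and their labels satisfy Coxeter-type relations
(`IsBlockSwap.isAdjSwap`). For such labels a sorting procedure that brings one letter after another
to the front defines a potential (`IsAdjSwap.eq_potential_sub`). Adding the cost of the initial
rotation gives Φ (`IsBlockSwap.eq_potential_sub`).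

For the homology, the partial resolution is continued by syzygies; Tor in degrees 0 and 1 sees only
its first three terms. Tensoring with the bar construction is computed by the co-Yoneda isomorphism
`yonedaEquiv`. -/

noncomputable section

namespace SymmetricHomology

/-! ### Block swaps of words: rotations and reduction to a fixed first letter. -/

section BlockSwaps

/-- A labelling of the block swaps `XYZ → ZYX` of words by elements of an additive group, subject
to the relations imposed by the second differential of the partial resolution. -/
structure IsBlockSwap {α G : Type*} [AddCommGroup G] (T : List α → List α → List α → G) :
    Prop where
  single : ∀ Y, T [] Y [] = 0
  four : ∀ X Y Z W,
    T (X ++ Y) Z W + T W (Z ++ X) Y + T (Y ++ (Z ++ X)) [] W + T W (Y ++ Z) X = 0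

namespace IsBlockSwap

variable {α G : Type*} [AddCommGroup G] {T : List α → List α → List α → G}

lemma left_only (hT : IsBlockSwap T) (X : List α) : T X [] [] = 0 := by
  have := hT.four [] [] X []
  simpa [hT.single] using this

/-- With one block empty, `T [] U V`, `T U [] V` and `T U V []` all label the rotation UV → VU.
Together with `rot_swap` and `rot_mid` this shows that the three labels agree and change sign when
the rotation is reversed. -/
lemma rot_left (hT : IsBlockSwap T) (U V : List α) : T [] U V = -T V U [] := by
  have := hT.four V [] U []
  simp only [List.nil_append, List.append_nil, hT.single, hT.left_only] at this
  grind only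

lemma rot_swap (hT : IsBlockSwap T) (U V : List α) : T V U [] = -T U V [] := by
  have := hT.four U V [] []
  simp only [List.nil_append, List.append_nil, hT.left_only, hT.rot_left] at this
  grind only

/-- Rotating XY to the back is the same as rotating X and then Y: XYZ → YZX → ZXY. -/
lemma rot_append (hT : IsBlockSwap T) (X Y Z : List α) :
    T (X ++ Y) Z [] = T X (Y ++ Z) [] + T Y (Z ++ X) [] := by
  have := hT.four X Y Z []
  simp only [hT.left_only, hT.rot_left] at this
  grind only

lemma rot_mid (hT : IsBlockSwap T) (U V : List α) : T U [] V = T U V [] := by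
  have := hT.four [] [] U V
  simp only [List.nil_append, List.append_nil, hT.rot_left, hT.rot_swap U V] at this
  grind only

lemma reverse (hT : IsBlockSwap T) (X Y Z : List α) : T Z Y X = -T X Y Z := by
  have := hT.four [] X Y Z
  simp only [List.nil_append, List.append_nil, hT.rot_mid, hT.rot_swap (X ++ Y) Z] at this
  grind only

/-- The edge XYZ → ZYX is traded for the path XYZ → ZXY → YXZ → ZYX, whose outer steps are
rotations. -/
lemma rotate (hT : IsBlockSwap T) (X Y Z : List α) :
    T Z X Y = T X Y Z - T (X ++ Y) Z [] - T (Y ++ X) Z [] := by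
  have := hT.four X Y [] Z
  simp only [List.nil_append, List.append_nil, hT.rot_mid, hT.reverse X Y Z] at this
  grind only

end IsBlockSwap

/-- The label of the rotation `Q o P → o P Q`. -/
def rotLabel {α G : Type*} (T : List α → List α → List α → G) (o : α) (Q P : List α) : G :=
  T Q (o :: P) []

/-- The label of the adjacent block swap `o P Y Z Q → o P Z Y Q`. -/
def adjLabel {α G : Type*} [AddCommGroup G] (T : List α → List α → List α → G) (o : α)
    (P Y Z Q : List α) : G :=
  T (Q ++ o :: P) Y Z - rotLabel T o Q (P ++ Y ++ Z) + rotLabel T o (Z ++ Y ++ Q) P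

namespace IsBlockSwap

variable {α G : Type*} [AddCommGroup G] {T : List α → List α → List α → G}

/-- Both ends of the rotation QoPV → VQoP rotate to the same word oPVQ with o in front, so its label
is a difference of two labels `rotLabel`. -/
lemma rot_eq (hT : IsBlockSwap T) (o : α) (Q P V : List α) :
    T (Q ++ o :: P) V [] = rotLabel T o Q (P ++ V) - rotLabel T o (V ++ Q) P := by
  have := hT.rot_append Q (o :: P) V
  simp only [rotLabel, hT.rot_swap (V ++ Q), List.cons_append] at this ⊢
  grind only

/-- This lemma, `mid_eq` and `right_eq` treat the three blocks in which o can lie. Each conjugates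
the block swap by the rotations that bring o to the front of its source and of its target; what
remains is an adjacent swap behind o. -/
lemma left_eq (T : List α → List α → List α → G) (o : α) (P Y Z Q : List α) :
    T (Q ++ o :: P) Y Z =
      adjLabel T o P Y Z Q + rotLabel T o Q (P ++ Y ++ Z) - rotLabel T o (Z ++ Y ++ Q) P := by
  simp only [adjLabel]; grind

lemma mid_eq (hT : IsBlockSwap T) (o : α) (P Y Z Q : List α) :
    T Y (Q ++ o :: P) Z =
      adjLabel T o P Z Y Q + rotLabel T o (Y ++ Q) (P ++ Z) - rotLabel T o (Z ++ Q) (P ++ Y) := by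
  have h1 := hT.rot_eq o Q (P ++ Z) Y
  have h2 := hT.rot_eq o (Z ++ Q) P Y
  rw [hT.rotate (Q ++ o :: P) Z Y, left_eq T]
  simp only [List.append_assoc, List.cons_append] at h1 h2 ⊢
  grind only

lemma right_eq (hT : IsBlockSwap T) (o : α) (P Y Z Q : List α) :
    T Y Z (Q ++ o :: P) =
      adjLabel T o P Y Z Q + rotLabel T o (Y ++ Z ++ Q) P - rotLabel T o Q (P ++ Z ++ Y) := by
  have h1 := hT.rot_eq o Q (P ++ Z) Y
  have h2 := hT.rot_eq o (Z ++ Q) P Y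
  rw [hT.rotate Z (Q ++ o :: P) Y, hT.mid_eq]
  simp only [List.append_assoc, List.cons_append] at h1 h2 ⊢
  grind only

lemma adj_swap (hT : IsBlockSwap T) (o : α) (P Y Z Q : List α) :
    adjLabel T o P Y Z Q = -adjLabel T o P Z Y Q := by
  have := hT.reverse (Q ++ o :: P) Z Y
  rw [hT.right_eq, left_eq T] at this
  grind only

/-- Moving YZ past W is moving Z past W and then Y past W. The relation comes from `four` with o
placed in its first block. -/
lemma adj_append_left (hT : IsBlockSwap T) (o : α) (P Y Z W Q : List α) :
    adjLabel T o P (Y ++ Z) W Q = adjLabel T o (P ++ Y) Z W Q + adjLabel T o P Y W (Z ++ Q) := by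
  have h := hT.four (Q ++ o :: P) Y Z W
  have h1 := left_eq T o (P ++ Y) Z W Q
  have h2 := hT.mid_eq o P W Y (Z ++ Q)
  have h3 := hT.rot_eq o (Y ++ Z ++ Q) P W
  have h4 := hT.right_eq o P W (Y ++ Z) Q
  have h5 := hT.adj_swap o P W (Y ++ Z) Q
  rw [hT.rot_mid] at h
  simp only [List.append_assoc, List.cons_append] at h h1 h2 h3 h4 h5 ⊢
  grind only

/-- The closed path XYZ → ZXY → YZX → XYZ behind oP has total label zero. The relation comes from
`four` with o placed in its last block. -/
lemma adj_hexagon (hT : IsBlockSwap T) (o : α) (P X Y Z Q : List α) :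
    adjLabel T o P (X ++ Y) Z Q + adjLabel T o P (Z ++ X) Y Q +
      adjLabel T o P (Y ++ Z) X Q = 0 := by
  have h := hT.four X Y Z (Q ++ o :: P)
  have h1 := hT.right_eq o P (X ++ Y) Z Q
  have h2 := left_eq T o P (Z ++ X) Y Q
  have h3 := hT.right_eq o P (Y ++ (Z ++ X)) [] Q
  have h4 := left_eq T o P (Y ++ Z) X Q
  have h5 := hT.adj_append_left o P [] [] (Y ++ (Z ++ X)) Q
  have h6 := hT.adj_swap o P [] (Y ++ (Z ++ X)) Q
  simp only [List.append_assoc, List.append_nil, List.nil_append] at h h1 h2 h3 h4 h5 h6 ⊢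
  grind only

end IsBlockSwap

/-! ### Adjacent block swaps: Coxeter-type relations and the sorting potential. -/

/-- A labelling `e P Y Z Q` of the adjacent block swaps `PYZQ → PZYQ` of words, subject to the
Coxeter-type relations. -/
structure IsAdjSwap {α G : Type*} [AddCommGroup G]
    (e : List α → List α → List α → List α → G) : Prop where
  swap : ∀ P Y Z Q, e P Y Z Q = -e P Z Y Q
  append_left : ∀ P Y Z W Q, e P (Y ++ Z) W Q = e (P ++ Y) Z W Q + e P Y W (Z ++ Q)
  hexagon : ∀ P X Y Z Q, e P (X ++ Y) Z Q + e P (Z ++ X) Y Q + e P (Y ++ Z) X Q = 0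

lemma IsBlockSwap.isAdjSwap {α G : Type*} [AddCommGroup G] {T : List α → List α → List α → G}
    (hT : IsBlockSwap T) (o : α) : IsAdjSwap (adjLabel T o) :=
  ⟨hT.adj_swap o, hT.adj_append_left o, hT.adj_hexagon o⟩

/-- The potential of a labelling of adjacent block swaps: the letters of the second argument are
moved to the front of the word one after the other, and the labels of the moves are added up. -/
def adjPotential {α G : Type*} [DecidableEq α] [AddCommGroup G]
    (e : List α → List α → List α → List α → G) : List α → List α → List α → G
  | _, [], _ => 0
  | D, l :: L, U =>
    e D (U.takeWhile (· ≠ l)) [l] (U.dropWhile (· ≠ l)).tail +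
      adjPotential e (D ++ [l]) L (U.takeWhile (· ≠ l) ++ (U.dropWhile (· ≠ l)).tail)

lemma takeWhile_ne_append_cons {α : Type*} [DecidableEq α] {l : α} {P : List α} (hl : l ∉ P)
    (R : List α) : (P ++ l :: R).takeWhile (· ≠ l) = P := by
  rw [List.takeWhile_append_of_pos]
  · simp
  · intro a ha; simpa using fun h : a = l => hl (h ▸ ha)

lemma tail_dropWhile_ne_append_cons {α : Type*} [DecidableEq α] {l : α} {P : List α}
    (hl : l ∉ P) (R : List α) : ((P ++ l :: R).dropWhile (· ≠ l)).tail = R := by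
  rw [List.dropWhile_append_of_pos]
  · simp
  · intro a ha; simpa using fun h : a = l => hl (h ▸ ha)

lemma adjPotential_cons {α G : Type*} [DecidableEq α] [AddCommGroup G]
    (e : List α → List α → List α → List α → G) (D L : List α) {l : α} {P : List α} (hl : l ∉ P)
    (R : List α) : adjPotential e D (l :: L) (P ++ l :: R) =
      e D P [l] R + adjPotential e (D ++ [l]) L (P ++ R) := by
  rw [adjPotential, takeWhile_ne_append_cons hl, tail_dropWhile_ne_append_cons hl]

namespace IsAdjSwap

variable {α G : Type*} [AddCommGroup G] {e : List α → List α → List α → List α → G}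

lemma nil_left (he : IsAdjSwap e) (P Z Q : List α) : e P [] Z Q = 0 := by
  have := he.append_left P [] [] Z Q
  simpa using this

lemma append_right (he : IsAdjSwap e) (P Y Z W Q : List α) :
    e P W (Y ++ Z) Q = e (P ++ Y) W Z Q + e P W Y (Z ++ Q) := by
  rw [he.swap, he.append_left, he.swap _ W, he.swap _ W, neg_add]

/-- Swaps at disjoint places commute. This is not an axiom: expanding the label of the swap of YZ
with WV by splitting the left block first, or the right block first, gives two sums whose other
terms cancel. -/
lemma comm_adjacent (he : IsAdjSwap e) (P Y W Z V Q : List α) :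
    e P Y W (Z ++ V ++ Q) - e P Y W (V ++ Z ++ Q) =
      e (P ++ Y ++ W) Z V Q - e (P ++ W ++ Y) Z V Q := by
  have h1 := he.append_left P Y Z (W ++ V) Q
  have h2 := he.append_right (P ++ Y) W V Z Q
  have h3 := he.append_right P W V Y (Z ++ Q)
  have h4 := he.append_right P W V (Y ++ Z) Q
  have h5 := he.append_left (P ++ W) Y Z V Q
  have h6 := he.append_left P Y Z W (V ++ Q)
  simp only [List.append_assoc] at h1 h2 h3 h4 h5 h6 ⊢
  grind only

/-- A gap R is absorbed by writing the swap of Y and W as the swap of Y and WR minus the later swap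
of Y and R; `comm_adjacent` applies to both. -/
lemma comm (he : IsAdjSwap e) (P Y W R Z V Q : List α) :
    e P Y W (R ++ Z ++ V ++ Q) - e P Y W (R ++ V ++ Z ++ Q) =
      e (P ++ Y ++ W ++ R) Z V Q - e (P ++ W ++ Y ++ R) Z V Q := by
  have h1 := he.append_right P W R Y (Z ++ V ++ Q)
  have h2 := he.append_right P W R Y (V ++ Z ++ Q)
  have h3 := he.comm_adjacent P Y (W ++ R) Z V Q
  have h4 := he.comm_adjacent (P ++ W) Y R Z V Q
  simp only [List.append_assoc] at h1 h2 h3 h4 ⊢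
  grind only

variable [DecidableEq α]

/-- Induction on the letters still to be sorted, with D the sorted prefix. Each case compares the
two ways of bringing the next letter l to the front, before and after the swap of Y and Z; the case
is decided by where l lies. -/
theorem eq_potential_sub (he : IsAdjSwap e) (L : List α) : ∀ (D P Y Z Q : List α),
    (P ++ Y ++ Z ++ Q).Perm L → L.Nodup →
      e (D ++ P) Y Z Q =
        adjPotential e D L (P ++ Y ++ Z ++ Q) - adjPotential e D L (P ++ Z ++ Y ++ Q) := by
  induction L with
  | nil =>
    intro D P Y Z Q h _
    simp only [List.perm_nil, List.append_eq_nil_iff] at h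
    obtain ⟨⟨⟨rfl, rfl⟩, rfl⟩, rfl⟩ := h
    simp [he.nil_left]
  | cons l L ih =>
    intro D P Y Z Q h hL
    have hl : l ∈ P ++ Y ++ Z ++ Q := h.symm.subset (by simp)
    -- The case where `l` is one of the two blocks.
    have single : ∀ P Y Q, (P ++ Y ++ [l] ++ Q).Perm (l :: L) → e (D ++ P) Y [l] Q =
        adjPotential e D (l :: L) (P ++ Y ++ [l] ++ Q) -
          adjPotential e D (l :: L) (P ++ [l] ++ Y ++ Q) := by
      intro P Y Q h
      have hc := (h.count_eq l).trans (List.count_eq_one_of_mem hL (by simp))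
      have h1 := adjPotential_cons e D L (l := l) (P := P ++ Y) (by
          simp only [← List.count_eq_zero, List.count_append, List.count_cons_self] at hc ⊢
          omega) Q
      have h2 := adjPotential_cons e D L (l := l) (P := P) (by
          simp only [← List.count_eq_zero, List.count_append, List.count_cons_self] at hc ⊢
          omega) (Y ++ Q)
      have h3 := he.append_left D P Y [l] Q
      simp only [List.append_assoc, List.cons_append, List.nil_append] at h1 h2 h3 ⊢
      grind only
    -- Here l moves to the front without meeting Y or Z, so `comm` and the induction hypothesis
    -- suffice.
    have left : ∀ P Y Z Q, (P ++ Y ++ Z ++ Q).Perm (l :: L) → l ∈ P → e (D ++ P) Y Z Q =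
        adjPotential e D (l :: L) (P ++ Y ++ Z ++ Q) -
          adjPotential e D (l :: L) (P ++ Z ++ Y ++ Q) := by
      intro P Y Z Q h hP
      have hc := (h.count_eq l).trans (List.count_eq_one_of_mem hL (by simp))
      obtain ⟨P₁, P₂, rfl⟩ := List.append_of_mem hP
      have h1 := adjPotential_cons e D L (l := l) (P := P₁) (by
          simp only [← List.count_eq_zero, List.count_append, List.count_cons_self] at hc ⊢
          omega) (P₂ ++ Y ++ Z ++ Q)
      have h2 := adjPotential_cons e D L (l := l) (P := P₁) (by
          simp only [← List.count_eq_zero, List.count_append, List.count_cons_self] at hc ⊢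
          omega) (P₂ ++ Z ++ Y ++ Q)
      have h3 := he.comm D P₁ [l] P₂ Y Z Q
      have hp : (P₁ ++ P₂ ++ Y ++ Z ++ Q).Perm L := by
        rw [← List.perm_cons l]
        refine List.Perm.trans ?_ h
        simp only [List.append_assoc, List.cons_append]
        exact List.perm_middle.symm
      have h4 := ih (D ++ [l]) (P₁ ++ P₂) Y Z Q hp (List.nodup_cons.1 hL).2
      simp only [List.append_assoc, List.cons_append, List.nil_append] at h1 h2 h3 h4 ⊢
      grind only
    -- Here l has to cross both Y and Z. The hexagon for Y, Z, l compares crossing them before and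
    -- after their swap; no other case applies it directly.
    have right : ∀ P Y Z Q, (P ++ Y ++ Z ++ Q).Perm (l :: L) → l ∈ Q → e (D ++ P) Y Z Q =
        adjPotential e D (l :: L) (P ++ Y ++ Z ++ Q) -
          adjPotential e D (l :: L) (P ++ Z ++ Y ++ Q) := by
      intro P Y Z Q h hQ
      have hc := (h.count_eq l).trans (List.count_eq_one_of_mem hL (by simp))
      obtain ⟨Q₁, Q₂, rfl⟩ := List.append_of_mem hQ
      have h1 := adjPotential_cons e D L (l := l) (P := P ++ Y ++ Z ++ Q₁) (by
          simp only [← List.count_eq_zero, List.count_append, List.count_cons_self] at hc ⊢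
          omega) Q₂
      have h2 := adjPotential_cons e D L (l := l) (P := P ++ Z ++ Y ++ Q₁) (by
          simp only [← List.count_eq_zero, List.count_append, List.count_cons_self] at hc ⊢
          omega) Q₂
      have hp : (P ++ Y ++ Z ++ (Q₁ ++ Q₂)).Perm L := by
        rw [← List.perm_cons l]
        refine List.Perm.trans ?_ h
        simpa using (List.perm_middle (l₁ := P ++ Y ++ Z ++ Q₁)).symm
      have h4 := ih (D ++ [l]) P Y Z (Q₁ ++ Q₂) hp (List.nodup_cons.1 hL).2
      have a1 := he.append_left D P (Y ++ Z ++ Q₁) [l] Q₂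
      have a2 := he.append_left (D ++ P) (Y ++ Z) Q₁ [l] Q₂
      have a4 := he.append_left D P (Z ++ Y ++ Q₁) [l] Q₂
      have a5 := he.append_left (D ++ P) (Z ++ Y) Q₁ [l] Q₂
      have c1 := he.comm D P [l] [] Y Z (Q₁ ++ Q₂)
      have c2 := he.comm_adjacent (D ++ P) Y Z Q₁ [l] Q₂
      have x1 := he.hexagon (D ++ P) Y Z [l] (Q₁ ++ Q₂)
      have x2 := he.append_left (D ++ P) [l] Y Z (Q₁ ++ Q₂)
      have x3 := he.append_left (D ++ P) Z [l] Y (Q₁ ++ Q₂)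
      have x4 := he.append_left (D ++ P) Z Y [l] (Q₁ ++ Q₂)
      have x5 := he.swap (D ++ P ++ Z) [l] Y (Q₁ ++ Q₂)
      have x6 := he.swap (D ++ P) Z Y ([l] ++ (Q₁ ++ Q₂))
      have x7 := he.swap (D ++ P) [l] Z (Y ++ (Q₁ ++ Q₂))
      simp only [List.append_assoc, List.cons_append, List.nil_append,
        List.append_nil] at h1 h2 h4 a1 a2 a4 a5 c1 c2 x1 x2 x3 x4 x5 x6 x7 ⊢
      grind only
    -- Cut Z at l and move Y past the three pieces in turn; for these moves l lies to the right, is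
    -- the block itself, and lies to the left.
    have second : ∀ P Y Z Q, (P ++ Y ++ Z ++ Q).Perm (l :: L) → l ∈ Z → e (D ++ P) Y Z Q =
        adjPotential e D (l :: L) (P ++ Y ++ Z ++ Q) -
          adjPotential e D (l :: L) (P ++ Z ++ Y ++ Q) := by
      intro P Y Z Q h hZ
      obtain ⟨Z₁, Z₂, rfl⟩ := List.append_of_mem hZ
      have a1 := he.append_right (D ++ P) Z₁ (l :: Z₂) Y Q
      have a2 := he.append_right (D ++ P ++ Z₁) [l] Z₂ Y Q
      have b1 := right P Y Z₁ (l :: Z₂ ++ Q) (by simpa using h) (by simp)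
      have b2 := single (P ++ Z₁) Y (Z₂ ++ Q) (by
        refine List.Perm.trans ?_ h
        simp only [List.append_assoc, List.cons_append, List.nil_append]
        refine List.Perm.append_left P ?_
        simpa using List.perm_append_comm.append_right (l :: (Z₂ ++ Q)))
      have b3 := left (P ++ Z₁ ++ [l]) Y Z₂ Q (by
        refine List.Perm.trans ?_ h
        simp only [List.append_assoc, List.cons_append, List.nil_append]
        refine List.Perm.append_left P ?_
        simpa using (List.perm_append_comm (l₁ := Z₁ ++ [l]) (l₂ := Y)).append_right (Z₂ ++ Q))
        (by simp)
      simp only [List.append_assoc, List.cons_append, List.nil_append] at a1 a2 b1 b2 b3 ⊢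
      grind only
    simp only [List.mem_append] at hl
    rcases hl with ((hl | hl) | hl) | hl
    · exact left P Y Z Q h hl
    · rw [he.swap, second P Z Y Q (List.Perm.trans (by
        simp only [List.append_assoc]
        refine List.Perm.append_left P ?_
        simpa using List.perm_append_comm.append_right Q) h) hl, neg_sub]
    · exact second P Y Z Q h hl
    · exact right P Y Z Q h hl

end IsAdjSwap

/-! ### The potential for all block swaps. -/

/-- The potential of a labelling of block swaps of the words in the letters `o, L`. -/
def swapPotential {α G : Type*} [DecidableEq α] [AddCommGroup G]
    (T : List α → List α → List α → G) (o : α) (L V : List α) : G :=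
  rotLabel T o (V.takeWhile (· ≠ o)) (V.dropWhile (· ≠ o)).tail +
    adjPotential (adjLabel T o) [] L ((V.dropWhile (· ≠ o)).tail ++ V.takeWhile (· ≠ o))

lemma swapPotential_eq {α G : Type*} [DecidableEq α] [AddCommGroup G]
    (T : List α → List α → List α → G) {o : α} (L : List α) {Q : List α} (ho : o ∉ Q)
    (P : List α) : swapPotential T o L (Q ++ o :: P) =
      rotLabel T o Q P + adjPotential (adjLabel T o) [] L (P ++ Q) := by
  rw [swapPotential, takeWhile_ne_append_cons ho, tail_dropWhile_ne_append_cons ho]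

/-- The rotation terms of `left_eq`, `mid_eq` and `right_eq` are the rotation parts of the two
potentials, and the remaining adjacent swap is covered by the sorting potential. -/
theorem IsBlockSwap.eq_potential_sub {α G : Type*} [DecidableEq α] [AddCommGroup G]
    {T : List α → List α → List α → G} (hT : IsBlockSwap T) {o : α} {L : List α}
    (hL : (o :: L).Nodup) (X Y Z : List α) (h : (X ++ Y ++ Z).Perm (o :: L)) :
    T X Y Z = swapPotential T o L (X ++ Y ++ Z) - swapPotential T o L (Z ++ Y ++ X) := by
  have he := (hT.isAdjSwap o).eq_potential_sub L
  have hc := (h.count_eq o).trans (List.count_eq_one_of_mem hL (by simp))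
  have hL' := (List.nodup_cons.1 hL).2
  have ho : o ∈ X ++ Y ++ Z := h.symm.subset (by simp)
  simp only [List.mem_append] at ho
  rcases ho with (ho | ho) | ho <;> obtain ⟨Q, P, rfl⟩ := List.append_of_mem ho
  · have h0 := left_eq T o P Y Z Q
    have h1 := swapPotential_eq T (o := o) L (Q := Q) (by
          simp only [← List.count_eq_zero, List.count_append, List.count_cons_self] at hc ⊢
          omega) (P ++ Y ++ Z)
    have h2 := swapPotential_eq T (o := o) L (Q := Z ++ Y ++ Q) (by
          simp only [← List.count_eq_zero, List.count_append, List.count_cons_self] at hc ⊢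
          omega) P
    have h3 := he [] P Y Z Q (by
      rw [← List.perm_cons o]
      refine List.Perm.trans ?_ h
      simpa using List.perm_append_comm (l₁ := o :: (P ++ Y ++ Z)) (l₂ := Q)) hL'
    simp only [List.append_assoc, List.cons_append, List.nil_append] at h0 h1 h2 h3 ⊢
    grind only
  · have h0 := hT.mid_eq o P X Z Q
    have h1 := swapPotential_eq T (o := o) L (Q := X ++ Q) (by
          simp only [← List.count_eq_zero, List.count_append, List.count_cons_self] at hc ⊢
          omega) (P ++ Z)
    have h2 := swapPotential_eq T (o := o) L (Q := Z ++ Q) (by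
          simp only [← List.count_eq_zero, List.count_append, List.count_cons_self] at hc ⊢
          omega) (P ++ X)
    have h3 := he [] P Z X Q (by
      rw [← List.perm_cons o]
      refine List.Perm.trans ?_ h
      simpa using List.perm_append_comm (l₁ := o :: (P ++ Z)) (l₂ := X ++ Q)) hL'
    simp only [List.append_assoc, List.cons_append, List.nil_append] at h0 h1 h2 h3 ⊢
    grind only
  · have h0 := hT.right_eq o P X Y Q
    have h1 := swapPotential_eq T (o := o) L (Q := X ++ Y ++ Q) (by
          simp only [← List.count_eq_zero, List.count_append, List.count_cons_self] at hc ⊢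
          omega) P
    have h2 := swapPotential_eq T (o := o) L (Q := Q) (by
          simp only [← List.count_eq_zero, List.count_append, List.count_cons_self] at hc ⊢
          omega) (P ++ Y ++ X)
    have h3 := he [] P X Y Q (by
      rw [← List.perm_cons o]
      refine List.Perm.trans ?_ h
      simpa using List.perm_append_comm (l₁ := o :: P) (l₂ := X ++ Y ++ Q)) hL'
    simp only [List.append_assoc, List.cons_append, List.nil_append] at h0 h1 h2 h3 ⊢
    grind only

end BlockSwaps

/-! ### Exactness of the partial resolution. -/

section Exactness

/-- Exactness of a complex of `Cᵒᵖ`-modules may be checked elementwise. -/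
lemma exact_of_app_exact {k : Type u} [CommRing k] {C : Type} [SmallCategory.{0} C]
    (S : ShortComplex (COpMod k C))
    (h : ∀ (X : C) (x : S.X₂.obj (op X)), (S.g.app (op X)).hom x = 0 →
      ∃ y, (S.f.app (op X)).hom y = x) :
    S.Exact := by
  rw [ShortComplex.exact_iff_isZero_homology]
  refine Functor.isZero _ fun X => ?_
  have h1 : (S.map ((evaluation _ _).obj X)).Exact := by
    rw [ShortComplex.moduleCat_exact_iff]
    exact h X.unop
  rw [ShortComplex.exact_iff_isZero_homology] at h1
  exact h1.of_iso (S.mapHomologyIso ((evaluation _ _).obj X)).symm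

/-- The basis element of `k[Mor_C(X, Y)]` given by a morphism. -/
def freeOpBasis (k : Type u) [CommRing k] {C : Type} [SmallCategory.{0} C] {X Y : C}
    (φ : X ⟶ Y) : (freeOp k Y).obj (op X) :=
  (Finsupp.single φ 1 : (X ⟶ Y) →₀ k)

lemma freeOp_app_ext (k : Type u) [CommRing k] {C : Type} [SmallCategory.{0} C] {X Y : C}
    {P : Type*} [AddCommGroup P] [Module k P] {f g : (freeOp k Y).obj (op X) →ₗ[k] P}
    (h : ∀ φ : X ⟶ Y, f (freeOpBasis k φ) = g (freeOpBasis k φ)) : f = g :=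
  Finsupp.lhom_ext' fun φ => LinearMap.ext_ring (h φ)

/-- The linear map out of `k[Mor_C(X, Y)]` with prescribed values on the basis. -/
def freeOpLift (k : Type u) [CommRing k] {C : Type} [SmallCategory.{0} C] {X Y : C}
    {P : Type*} [AddCommGroup P] [Module k P] (s : (X ⟶ Y) → P) :
    (freeOp k Y).obj (op X) →ₗ[k] P :=
  Finsupp.lsum k fun φ => LinearMap.toSpanSingleton k _ (s φ)

lemma freeOpLift_basis (k : Type u) [CommRing k] {C : Type} [SmallCategory.{0} C] {X Y : C}
    {P : Type*} [AddCommGroup P] [Module k P] (s : (X ⟶ Y) → P) (φ : X ⟶ Y) :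
    freeOpLift k s (freeOpBasis k φ) = s φ := by
  refine (Finsupp.lsum_single (R := k) (M := k) (S := k) _ φ 1).trans ?_
  simp

lemma freeOpMap_basis (k : Type u) [CommRing k] {C : Type} [SmallCategory.{0} C] {X Y Z : C}
    (f : Y ⟶ Z) (φ : X ⟶ Y) :
    ((freeOpMap k f).app (op X)).hom (freeOpBasis k φ) = freeOpBasis k (φ ≫ f) :=
  Finsupp.mapDomain_single

/-- The augmentation at an object, as a linear map to `k`. -/
def augmentationAt (k : Type u) [CommRing k] {C : Type} [SmallCategory.{0} C] (X Y : C) :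
    (freeOp k Y).obj (op X) →ₗ[k] k :=
  ((augmentation k Y).app (op X)).hom

lemma augmentationAt_basis (k : Type u) [CommRing k] {C : Type} [SmallCategory.{0} C] {X Y : C}
    (φ : X ⟶ Y) : augmentationAt k X Y (freeOpBasis k φ) = 1 :=
  Finsupp.lsum_single (R := k) (M := k) (S := k) (fun _ => LinearMap.id) φ 1

/-- Each letter occurs exactly once in the word. -/
def IsOnce {n : ℕ} (V : List (Fin n)) : Prop := ∀ i, V.count i = 1

lemma isOnce_finRange (n : ℕ) : IsOnce (List.finRange n) := fun i =>
  List.count_eq_one_of_mem (List.nodup_finRange n) (List.mem_finRange i)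

lemma IsOnce.perm {n : ℕ} {V W : List (Fin n)} (hV : IsOnce V) (hW : IsOnce W) : V.Perm W :=
  List.perm_iff_count.2 fun i => (hV i).trans (hW i).symm

/-- The morphism `[n] → [0]` given by a single word. -/
def hom₀ {X : DeltaS} (V : List (Fin (X.n + 1))) (h : IsOnce V) : X ⟶ obj 0 :=
  DeltaS.Hom.mk ![V] fun i => by simpa using h i

/-- The morphism `[n] → [2]` given by three words. -/
def hom₂ {X : DeltaS} (U V W : List (Fin (X.n + 1))) (h : IsOnce (U ++ V ++ W)) : X ⟶ obj 2 :=
  DeltaS.Hom.mk ![U, V, W] fun i => by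
    have := h i
    simp only [List.count_append] at this
    simpa [Fin.sum_univ_succ, add_assoc] using this

/-- The morphism `[n] → [3]` given by four words. -/
def hom₃ {X : DeltaS} (U V W Z : List (Fin (X.n + 1))) (h : IsOnce (U ++ V ++ W ++ Z)) :
    X ⟶ obj 3 :=
  DeltaS.Hom.mk ![U, V, W, Z] fun i => by
    have := h i
    simp only [List.count_append] at this
    simpa [Fin.sum_univ_succ, add_assoc] using this

lemma exists_eq_hom₀ {X : DeltaS} (φ : X ⟶ obj 0) : ∃ V h, φ = hom₀ V h := by
  refine ⟨DeltaS.words φ 0, fun i => by simpa using! DeltaS.Hom.once φ i, ?_⟩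
  refine DeltaS.Hom.ext ?_
  funext j
  fin_cases j
  rfl

lemma exists_eq_hom₂ {X : DeltaS} (φ : X ⟶ obj 2) : ∃ U V W h, φ = hom₂ U V W h := by
  refine ⟨DeltaS.words φ 0, DeltaS.words φ 1, DeltaS.words φ 2, fun i => ?_, ?_⟩
  · have := DeltaS.Hom.once φ i
    rw [Fin.sum_univ_three] at this
    simp only [List.count_append]
    exact this
  · refine DeltaS.Hom.ext ?_
    funext j
    fin_cases j <;> rfl

lemma hom₂_comp_ofWords₀ {X : DeltaS} (U V W : List (Fin (X.n + 1))) (h : IsOnce (U ++ V ++ W))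
    (w : List (Fin 3)) (hw) (h') :
    hom₂ U V W h ≫ DeltaS.ofWords (n := 2) (m := 0) ![w] hw =
      hom₀ (w.flatMap ![U, V, W]) h' := by
  refine DeltaS.Hom.ext ?_
  funext j
  fin_cases j
  rfl

lemma hom₃_comp_ofWords₂ {X : DeltaS} (U V W Z : List (Fin (X.n + 1)))
    (h : IsOnce (U ++ V ++ W ++ Z)) (a b c : List (Fin 4)) (hw) (h') :
    hom₃ U V W Z h ≫ DeltaS.ofWords (n := 3) (m := 2) ![a, b, c] hw =
      hom₂ (a.flatMap ![U, V, W, Z]) (b.flatMap ![U, V, W, Z]) (c.flatMap ![U, V, W, Z]) h' := by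
  refine DeltaS.Hom.ext ?_
  funext j
  fin_cases j <;> rfl

lemma hom₀_comp_ofWords₂ {X : DeltaS} (V : List (Fin (X.n + 1)))
    (h : IsOnce V) (a b c : List (Fin 1)) (hw) (h') :
    hom₀ V h ≫ DeltaS.ofWords (n := 0) (m := 2) ![a, b, c] hw =
      hom₂ (a.flatMap ![V]) (b.flatMap ![V]) (c.flatMap ![V]) h' := by
  refine DeltaS.Hom.ext ?_
  funext j
  fin_cases j <;> rfl

lemma IsOnce.of_perm {n : ℕ} {V W : List (Fin n)} (hV : IsOnce V) (h : V.Perm W) : IsOnce W :=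
  fun i => (h.count_eq i).symm.trans (hV i)

lemma rho_app_hom₂ (k : Type u) [CommRing k] (X : DeltaS)
    (U V W : List (Fin (X.n + 1))) (h : IsOnce (U ++ V ++ W)) (h' : IsOnce (W ++ V ++ U)) :
    ((rho k).app (op X)).hom (freeOpBasis k (hom₂ U V W h)) =
      freeOpBasis k (hom₀ (U ++ V ++ W) h) - freeOpBasis k (hom₀ (W ++ V ++ U) h') := by
  change ((freeOpMap k _).app (op X)).hom _ - ((freeOpMap k _).app (op X)).hom _ = _
  rw [freeOpMap_basis, freeOpMap_basis,
    hom₂_comp_ofWords₀ (h' := by simpa using h), hom₂_comp_ofWords₀ (h' := by simpa using h')]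
  congr 3 <;> simp

lemma alpha_app_hom₃ (k : Type u) [CommRing k] (X : DeltaS)
    (U V W Z : List (Fin (X.n + 1))) (h : IsOnce (U ++ V ++ W ++ Z))
    (h₁ : IsOnce ((U ++ V) ++ W ++ Z)) (h₂ : IsOnce (Z ++ (W ++ U) ++ V))
    (h₃ : IsOnce ((V ++ (W ++ U)) ++ [] ++ Z)) (h₄ : IsOnce (Z ++ (V ++ W) ++ U)) :
    ((alpha k).app (op X)).hom (freeOpBasis k (hom₃ U V W Z h)) =
      freeOpBasis k (hom₂ (U ++ V) W Z h₁) + freeOpBasis k (hom₂ Z (W ++ U) V h₂) +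
        freeOpBasis k (hom₂ (V ++ (W ++ U)) [] Z h₃) +
        freeOpBasis k (hom₂ Z (V ++ W) U h₄) := by
  change ((freeOpMap k _).app (op X)).hom _ + ((freeOpMap k _).app (op X)).hom _ +
    ((freeOpMap k _).app (op X)).hom _ + ((freeOpMap k _).app (op X)).hom _ = _
  rw [freeOpMap_basis, freeOpMap_basis, freeOpMap_basis, freeOpMap_basis,
    hom₃_comp_ofWords₂ (h' := by simpa using h₁), hom₃_comp_ofWords₂ (h' := by simpa using h₂),
    hom₃_comp_ofWords₂ (h' := by simpa using h₃), hom₃_comp_ofWords₂ (h' := by simpa using h₄)]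
  congr 2
  · congr 2
    · congr 2 <;> simp
    · congr 2 <;> simp
  · congr 2 <;> simp
  · simp

lemma beta_app_hom₀ (k : Type u) [CommRing k] (X : DeltaS)
    (V : List (Fin (X.n + 1))) (h : IsOnce V) (h' : IsOnce ([] ++ V ++ [])) :
    ((beta k).app (op X)).hom (freeOpBasis k (hom₀ V h)) =
      freeOpBasis k (hom₂ [] V [] h') := by
  change ((freeOpMap k _).app (op X)).hom _ = _
  rw [freeOpMap_basis, hom₀_comp_ofWords₂ (h' := by simpa using h')]
  congr 2
  simp

lemma rho_comp_augmentation (k : Type u) [CommRing k] :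
    rho k ≫ augmentation k (obj 0) = 0 := by
  refine freeOp_hom_ext k ?_
  change augmentationAt k _ _
    (((freeOpMap k _).app _).hom (freeOpBasis k _) -
      ((freeOpMap k _).app _).hom (freeOpBasis k _)) = 0
  rw [map_sub, freeOpMap_basis, freeOpMap_basis, augmentationAt_basis,
    augmentationAt_basis, sub_self]

lemma exists_eq_hom₃ {X : DeltaS} (φ : X ⟶ obj 3) : ∃ U V W Z h, φ = hom₃ U V W Z h := by
  refine ⟨DeltaS.words φ 0, DeltaS.words φ 1, DeltaS.words φ 2, DeltaS.words φ 3,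
    fun i => ?_, ?_⟩
  · have := DeltaS.Hom.once φ i
    rw [Fin.sum_univ_four] at this
    simp only [List.count_append]
    exact this
  · refine DeltaS.Hom.ext ?_
    funext j
    fin_cases j <;> rfl

lemma alpha_comp_rho (k : Type u) [CommRing k] : alpha k ≫ rho k = 0 := by
  ext X : 2
  refine ModuleCat.hom_ext (freeOp_app_ext k fun φ => ?_)
  obtain ⟨U, V, W, Z, h, rfl⟩ := exists_eq_hom₃ φ
  have hp : ∀ {V'}, (U ++ V ++ W ++ Z).Perm V' → IsOnce V' := h.of_perm
  have h₂ : IsOnce (Z ++ (W ++ U) ++ V) := hp (by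
    rw [List.perm_iff_count]; intro a; simp only [List.count_append]; omega)
  have h₃ : IsOnce ((V ++ (W ++ U)) ++ [] ++ Z) := hp (by
    rw [List.perm_iff_count]; intro a; simp only [List.count_append, List.count_nil]; omega)
  have h₄ : IsOnce (Z ++ (V ++ W) ++ U) := hp (by
    rw [List.perm_iff_count]; intro a; simp only [List.count_append]; omega)
  change ((rho k).app (op X.unop)).hom (((alpha k).app (op X.unop)).hom _) = 0
  rw [alpha_app_hom₃ k X.unop U V W Z h h h₂ h₃ h₄, map_add, map_add, map_add,
    rho_app_hom₂ k X.unop (h' := by simpa using h₂),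
    rho_app_hom₂ k X.unop (h' := by simpa using h₃),
    rho_app_hom₂ k X.unop (h' := by simpa using h₄),
    rho_app_hom₂ k X.unop (h' := by simpa using h)]
  simp only [List.append_assoc, List.nil_append]
  abel

lemma beta_comp_rho (k : Type u) [CommRing k] : beta k ≫ rho k = 0 := by
  ext X : 2
  refine ModuleCat.hom_ext (freeOp_app_ext k fun φ => ?_)
  obtain ⟨V, h, rfl⟩ := exists_eq_hom₀ φ
  change ((rho k).app (op X.unop)).hom (((beta k).app (op X.unop)).hom _) = 0
  rw [beta_app_hom₀ k X.unop V h (by simpa using h), rho_app_hom₂ k X.unop (h' := by simpa using h),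
    sub_self]

instance epi_augmentation (k : Type u) [CommRing k] : Epi (augmentation k (obj 0)) := by
  refine (NatTrans.epi_iff_epi_app _).2 fun X => (ModuleCat.epi_iff_surjective _).2 fun c => ?_
  refine ⟨(show k from c) • freeOpBasis k (hom₀ (List.finRange _) (isOnce_finRange _)), ?_⟩
  change augmentationAt k X.unop _ _ = (show k from c)
  rw [map_smul, augmentationAt_basis, smul_eq_mul, mul_one]

/-- A function on words that is invariant under `XYZ ↦ ZYX` is invariant under permutations. -/
lemma eq_of_perm_of_block_swap {α β : Type*} (f : List α → β)
    (hf : ∀ X Y Z, f (X ++ Y ++ Z) = f (Z ++ Y ++ X)) {V W : List α} (h : V.Perm W) :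
    f V = f W := by
  -- The hypothesis concerns whole words only, so an arbitrary prefix is carried through the
  -- induction on the permutation.
  have key : ∀ P, f (P ++ V) = f (P ++ W) := by
    induction h with
    | nil => exact fun _ => rfl
    | cons a _ ih => intro P; simpa using ih (P ++ [a])
    | trans _ _ ih₁ ih₂ => exact fun P => (ih₁ P).trans (ih₂ P)
    | swap a b Q =>
      intro P
      -- The transposition is the path PbaQ → aQPb → bQPa → PabQ.
      have h1 := hf (P ++ [b]) [] (a :: Q)
      have h2 := hf [a] (Q ++ P) [b]
      have h3 := hf (b :: Q) [] (P ++ [a])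
      simp only [List.append_assoc, List.cons_append, List.nil_append, List.append_nil] at *
      exact h1.trans (h2.trans h3)
  exact key []

-- Modulo the image of `rho` all words become equal, so the quotient map factors through the
-- augmentation.
open Classical in
theorem rho_exact (k : Type u) [CommRing k] :
    (ShortComplex.mk _ _ (rho_comp_augmentation k)).Exact := by
  refine exact_of_app_exact _ fun X z hz => ?_
  let R := LinearMap.range ((rho k).app (op X)).hom
  -- The value 0 on other words makes f total; since block swaps preserve `IsOnce`, its invariance
  -- holds for all words.
  let f : List (Fin (X.n + 1)) → (freeOp k (obj 0)).obj (op X) ⧸ R := fun V =>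
    if h : IsOnce V then R.mkQ (freeOpBasis k (hom₀ V h)) else 0
  have hf : ∀ U V W, f (U ++ V ++ W) = f (W ++ V ++ U) := by
    intro U V W
    have hp : (U ++ V ++ W).Perm (W ++ V ++ U) := by
      rw [List.perm_iff_count]; intro a; simp only [List.count_append]; omega
    by_cases h : IsOnce (U ++ V ++ W)
    · have h' := h.of_perm hp
      simp only [f, dif_pos h, dif_pos h']
      rw [← sub_eq_zero, ← map_sub, Submodule.mkQ_apply, Submodule.Quotient.mk_eq_zero]
      exact ⟨_, rho_app_hom₂ k X U V W h h'⟩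
    · have h' : ¬ IsOnce (W ++ V ++ U) := fun h' => h (h'.of_perm hp.symm)
      simp only [f, dif_neg h, dif_neg h']
  have key : R.mkQ = (LinearMap.toSpanSingleton k _ (f (List.finRange _))).comp
      (augmentationAt k X (obj 0)) := by
    refine freeOp_app_ext k fun φ => ?_
    obtain ⟨V, h, rfl⟩ := exists_eq_hom₀ φ
    rw [LinearMap.comp_apply, augmentationAt_basis, LinearMap.toSpanSingleton_apply_one,
      ← eq_of_perm_of_block_swap f hf (h.perm (isOnce_finRange _))]
    simp only [f, dif_pos h]
  have hz' : R.mkQ z = 0 := by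
    rw [key, LinearMap.comp_apply, show augmentationAt k X (obj 0) z = 0 from hz, map_zero]
  rwa [Submodule.mkQ_apply, Submodule.Quotient.mk_eq_zero] at hz'

lemma desc_comp_rho (k : Type u) [CommRing k] : biprod.desc (alpha k) (beta k) ≫ rho k = 0 := by
  refine biprod.hom_ext' _ _ ?_ ?_
  · rw [biprod.inl_desc_assoc, alpha_comp_rho, comp_zero]
  · rw [biprod.inr_desc_assoc, beta_comp_rho, comp_zero]

-- The classes of the basis elements modulo the image of (`alpha`, `beta`) form a block-swap
-- labelling: `beta` gives the relation `single`, `alpha` gives `four`. The potential of this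
-- labelling factors the quotient map through `rho`.
open Classical in
theorem desc_exact (k : Type u) [CommRing k] :
    (ShortComplex.mk _ _ (desc_comp_rho k)).Exact := by
  refine exact_of_app_exact _ fun X z hz => ?_
  let R := LinearMap.range ((biprod.desc (alpha k) (beta k)).app (op X)).hom
  have hα : ∀ y, ((alpha k).app (op X)).hom y ∈ R := fun y =>

    ⟨((biprod.inl : _ ⟶ freeOp k (obj 3) ⊞ freeOp k (obj 0)).app (op X)).hom y,
      congrArg (fun t : freeOp k (obj 3) ⟶ freeOp k (obj 2) => (t.app (op X)).hom y)
        (biprod.inl_desc _ _)⟩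
  have hβ : ∀ y, ((beta k).app (op X)).hom y ∈ R := fun y =>

    ⟨((biprod.inr : _ ⟶ freeOp k (obj 3) ⊞ freeOp k (obj 0)).app (op X)).hom y,
      congrArg (fun t : freeOp k (obj 0) ⟶ freeOp k (obj 2) => (t.app (op X)).hom y)
        (biprod.inr_desc _ _)⟩
  let T : List (Fin (X.n + 1)) → List (Fin (X.n + 1)) → List (Fin (X.n + 1)) →
      (freeOp k (obj 2)).obj (op X) ⧸ R := fun U V W =>
    if h : IsOnce (U ++ V ++ W) then R.mkQ (freeOpBasis k (hom₂ U V W h)) else 0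
  have hT : IsBlockSwap T := by
    constructor
    · intro Y
      by_cases h : IsOnce ([] ++ Y ++ [])
      · simp only [T, dif_pos h]
        rw [Submodule.mkQ_apply, Submodule.Quotient.mk_eq_zero,
          ← beta_app_hom₀ k X Y (by simpa using h) h]
        exact hβ _
      · simp only [T, dif_neg h]
    · intro U V W Z
      have p₂ : (U ++ V ++ W ++ Z).Perm (Z ++ (W ++ U) ++ V) := by
        rw [List.perm_iff_count]; intro a; simp only [List.count_append]; omega
      have p₃ : (U ++ V ++ W ++ Z).Perm (V ++ (W ++ U) ++ [] ++ Z) := by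
        rw [List.perm_iff_count]; intro a; simp only [List.count_append, List.count_nil]; omega
      have p₄ : (U ++ V ++ W ++ Z).Perm (Z ++ (V ++ W) ++ U) := by
        rw [List.perm_iff_count]; intro a; simp only [List.count_append]; omega
      by_cases h : IsOnce (U ++ V ++ W ++ Z)
      · have h₂ := h.of_perm p₂
        have h₃ := h.of_perm p₃
        have h₄ := h.of_perm p₄
        simp only [T, dif_pos h, dif_pos h₂, dif_pos h₃, dif_pos h₄]
        rw [← map_add, ← map_add, ← map_add, Submodule.mkQ_apply, Submodule.Quotient.mk_eq_zero]
        rw [← alpha_app_hom₃ k X U V W Z h h h₂ h₃ h₄]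
        exact hα _
      · have h₂ : ¬ IsOnce (Z ++ (W ++ U) ++ V) := fun h' => h (h'.of_perm p₂.symm)
        have h₃ : ¬ IsOnce (V ++ (W ++ U) ++ [] ++ Z) := fun h' => h (h'.of_perm p₃.symm)
        have h₄ : ¬ IsOnce (Z ++ (V ++ W) ++ U) := fun h' => h (h'.of_perm p₄.symm)
        simp only [T, dif_neg h, dif_neg h₂, dif_neg h₃, dif_neg h₄, add_zero]
  -- A letter o exists because [n] is never empty.
  obtain ⟨o, L, hL⟩ : ∃ o L, List.finRange (X.n + 1) = o :: L := ⟨_, _, List.finRange_succ⟩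
  have key : R.mkQ = (freeOpLift k fun φ : X ⟶ obj 0 =>
      swapPotential T o L (DeltaS.words φ 0)).comp ((rho k).app (op X)).hom := by
    refine freeOp_app_ext k fun φ => ?_
    obtain ⟨U, V, W, h, rfl⟩ := exists_eq_hom₂ φ
    have h' : IsOnce (W ++ V ++ U) := h.of_perm (by
      rw [List.perm_iff_count]; intro a; simp only [List.count_append]; omega)
    have := hT.eq_potential_sub (hL ▸ List.nodup_finRange _) U V W
      (hL ▸ h.perm (isOnce_finRange _))
    rw [LinearMap.comp_apply, rho_app_hom₂ k X U V W h h', map_sub, freeOpLift_basis,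
      freeOpLift_basis]
    simp only [T, dif_pos h] at this
    exact this
  have hz' : R.mkQ z = 0 := by
    rw [key, LinearMap.comp_apply, show ((rho k).app (op X)).hom z = 0 from hz, map_zero]
  rwa [Submodule.mkQ_apply, Submodule.Quotient.mk_eq_zero] at hz'

end Exactness

/-! ### Tensor powers as iterated binary tensor products. -/

section TensorPowers

variable (k : Type*) [CommRing k] (A : Type*) [AddCommGroup A] [Module k A]

/-- `A^{⊗(n+1)} ≃ A ⊗ A^{⊗n}`. -/
def tensorPowerSucc (n : ℕ) : (⨂[k]^(n + 1) A) ≃ₗ[k] A ⊗[k] (⨂[k]^n A) :=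
  (PiTensorProduct.reindex k (fun _ => A)
      (finSumFinEquiv.trans (finCongr (add_comm 1 n))).symm).trans
    ((PiTensorProduct.tmulEquiv k A).symm.trans
      (TensorProduct.congr (PiTensorProduct.subsingletonEquiv (0 : Fin 1)) (LinearEquiv.refl k _)))

lemma tensorPowerSucc_tprod (n : ℕ) (a : Fin (n + 1) → A) :
    tensorPowerSucc k A n (PiTensorProduct.tprod k a) =
      a 0 ⊗ₜ[k] (PiTensorProduct.tprod k (fun i => a i.succ) : ⨂[k]^n A) := by
  rw [tensorPowerSucc, LinearEquiv.trans_apply, PiTensorProduct.reindex_tprod,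
    LinearEquiv.trans_apply]
  erw [PiTensorProduct.tmulEquiv_symm_apply]
  erw [TensorProduct.congr_tmul, PiTensorProduct.subsingletonEquiv_apply_tprod]
  have h : (fun i => a ((finSumFinEquiv.trans (finCongr (add_comm 1 n))).symm.symm (Sum.inr i))) =
      fun i : Fin n => a i.succ :=
    funext fun i => congrArg a (Fin.ext (by simp))
  exact congrArg (fun b : Fin n → A => a 0 ⊗ₜ[k] (PiTensorProduct.tprod k b : ⨂[k]^n A)) h

/-- `A^{⊗1} ≃ A`. -/
def tensorPowerOne : (⨂[k]^1 A) ≃ₗ[k] A :=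
  PiTensorProduct.subsingletonEquiv (0 : Fin 1)

lemma tensorPowerOne_tprod (a : Fin 1 → A) :
    tensorPowerOne k A (PiTensorProduct.tprod k a) = a 0 :=
  PiTensorProduct.subsingletonEquiv_apply_tprod (0 : Fin 1) a

/-- `A^{⊗3} ≃ A ⊗ (A ⊗ A)`. -/
def tensorPowerThree : (⨂[k]^3 A) ≃ₗ[k] A ⊗[k] (A ⊗[k] A) :=
  (tensorPowerSucc k A 2).trans (TensorProduct.congr (LinearEquiv.refl k A)
    ((tensorPowerSucc k A 1).trans
      (TensorProduct.congr (LinearEquiv.refl k A) (tensorPowerOne k A))))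

lemma tensorPowerThree_tprod (a : Fin 3 → A) :
    tensorPowerThree k A (PiTensorProduct.tprod k a) = a 0 ⊗ₜ[k] (a 1 ⊗ₜ[k] a 2) := by
  rw [tensorPowerThree, LinearEquiv.trans_apply, tensorPowerSucc_tprod, TensorProduct.congr_tmul,
    LinearEquiv.trans_apply, tensorPowerSucc_tprod, TensorProduct.congr_tmul, tensorPowerOne_tprod]
  rfl

/-- `A^{⊗4} ≃ A ⊗ (A ⊗ (A ⊗ A))`. -/
def tensorPowerFour : (⨂[k]^4 A) ≃ₗ[k] A ⊗[k] (A ⊗[k] (A ⊗[k] A)) :=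
  (tensorPowerSucc k A 3).trans
    (TensorProduct.congr (LinearEquiv.refl k A) (tensorPowerThree k A))

lemma tensorPowerFour_tprod (a : Fin 4 → A) :
    tensorPowerFour k A (PiTensorProduct.tprod k a) =
      a 0 ⊗ₜ[k] (a 1 ⊗ₜ[k] (a 2 ⊗ₜ[k] a 3)) := by
  rw [tensorPowerFour, LinearEquiv.trans_apply, tensorPowerSucc_tprod, TensorProduct.congr_tmul,
    tensorPowerThree_tprod]
  rfl

end TensorPowers

/-! ### The co-Yoneda isomorphism. -/

section Yoneda

lemma freeOp_map_basis (k : Type u) [CommRing k] {C : Type} [SmallCategory.{0} C] {X X' Y : C}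
    (f : X ⟶ X') (φ : X' ⟶ Y) :
    ((freeOp k Y).map f.op).hom (freeOpBasis k φ) = freeOpBasis k (f ≫ φ) :=
  Finsupp.mapDomain_single

variable (k : Type u) [CommRing k] {C : Type} [SmallCategory.{0} C] [DecidableEq C]

lemma catTensor.mk_map (M : COpMod k C) (N : CMod k C) {X Y : C} (f : X ⟶ Y)
    (y : M.obj (op Y)) (x : N.obj X) :
    catTensor.mk k M N X ((M.map f.op).hom y) x = catTensor.mk k M N Y y ((N.map f).hom x) := by
  refine Eq.symm ((Submodule.Quotient.eq _).2 (Submodule.subset_span ⟨X, Y, f, x, y, rfl⟩))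

/-- The class `y ⊗ x` in `M ⊗_C N`, as a bilinear map. -/
def catTensor.mkLinear (M : COpMod k C) (N : CMod k C) (X : C) :
    M.obj (op X) →ₗ[k] N.obj X →ₗ[k] catTensor k M N :=
  (TensorProduct.mk k _ _).compr₂ ((tensorRel k M N).mkQ ∘ₗ
    DirectSum.lof k C (fun X => M.obj (op X) ⊗[k] N.obj X) X)

lemma catTensor.freeOp_hom_ext {Y : C} {N : CMod k C} {P : Type u} [AddCommGroup P] [Module k P]
    {f g : catTensor k (freeOp k Y) N →ₗ[k] P}
    (h : ∀ (X : C) (φ : X ⟶ Y) (x : N.obj X), f (catTensor.mk k _ N X (freeOpBasis k φ) x) =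
      g (catTensor.mk k _ N X (freeOpBasis k φ) x)) : f = g := by
  refine catTensor.hom_ext k fun X y x => ?_
  have : (catTensor.mkLinear k (freeOp k Y) N X).compr₂ f =
      (catTensor.mkLinear k (freeOp k Y) N X).compr₂ g :=
    freeOp_app_ext k fun φ => LinearMap.ext fun x => h X φ x
  exact LinearMap.congr_fun₂ this y x

/-- The evaluation `φ ⊗ x ↦ φ_*(x)`. -/
def yonedaEval (Y : C) (N : CMod k C) : catTensor k (freeOp k Y) N →ₗ[k] N.obj Y :=
  (tensorRel k (freeOp k Y) N).liftQ
    (DirectSum.toModule k C _ fun X =>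
      TensorProduct.lift (freeOpLift k fun φ : X ⟶ Y => (N.map φ).hom)) (by
    rw [tensorRel, Submodule.span_le]
    rintro _ ⟨X, X', f, x, y, rfl⟩
    have : (freeOpLift k fun φ : X' ⟶ Y => (N.map φ).hom).compl₂ (N.map f).hom =
        (freeOpLift k fun φ : X ⟶ Y => (N.map φ).hom) ∘ₗ ((freeOp k Y).map f.op).hom := by
      refine freeOp_app_ext k fun φ => LinearMap.ext fun x => ?_
      rw [LinearMap.compl₂_apply, LinearMap.comp_apply, freeOp_map_basis, freeOpLift_basis,
        freeOpLift_basis, N.map_comp]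
      rfl
    have := LinearMap.congr_fun₂ this y x
    simp only [SetLike.mem_coe, LinearMap.mem_ker, map_sub, DirectSum.toModule_lof,
      TensorProduct.lift.tmul]
    exact sub_eq_zero.2 this)

lemma yonedaEval_mk {X Y : C} (N : CMod k C) (φ : X ⟶ Y) (x : N.obj X) :
    yonedaEval k Y N (catTensor.mk k _ N X (freeOpBasis k φ) x) = (N.map φ).hom x := by
  refine (Submodule.liftQ_apply _ _ _).trans ?_
  rw [DirectSum.toModule_lof, TensorProduct.lift.tmul, freeOpLift_basis]

/-- The co-Yoneda isomorphism `k[Mor_C(-, Y)] ⊗_C N ≃ N(Y)`. -/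
def yonedaEquiv (Y : C) (N : CMod k C) : catTensor k (freeOp k Y) N ≃ₗ[k] N.obj Y :=
  LinearEquiv.ofLinearMap (yonedaEval k Y N) (catTensor.mkLinear k _ N Y (freeOpBasis k (𝟙 Y)))
    (by
      ext x
      exact (yonedaEval_mk k N (𝟙 Y) x).trans (by simp))
    (by
      refine catTensor.freeOp_hom_ext k fun X φ x => ?_
      rw [LinearMap.comp_apply, yonedaEval_mk, LinearMap.id_apply]
      refine (catTensor.mk_map k _ N φ (freeOpBasis k (𝟙 Y)) x).symm.trans ?_
      rw [freeOp_map_basis, Category.comp_id])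

end Yoneda

/-! ### Evaluation on the bar construction. -/

section Evaluation

variable (k : Type u) [CommRing k] {A : Type u} [Ring A] [Algebra k A]

lemma tensorFunctor_map_gen {X Y Z : DeltaS} (f : Y ⟶ Z) (φ : X ⟶ Y) (a : Fin (X.n + 1) → A) :
    ((tensorFunctor k (symBar k A)).map (freeOpMap k f)).hom (gen k φ a) = gen k (φ ≫ f) a := by
  refine (catTensor.map_mk k _ _ _ _ _).trans ?_
  exact congrArg (fun y => catTensor.mk k (freeOp k Z) (symBar k A) X y
    (PiTensorProduct.tprod k a : ⨂[k]^(X.n + 1) A)) (freeOpMap_basis k f φ)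

/-- Evaluation on the bar construction. -/
def evalBar (Y : DeltaS) :
    (tensorFunctor k (symBar k A)).obj (freeOp k Y) ≃ₗ[k] ⨂[k]^(Y.n + 1) A :=
  yonedaEquiv k Y (symBar k A)

lemma evalBar_gen {X Y : DeltaS} (φ : X ⟶ Y) (a : Fin (X.n + 1) → A) :
    evalBar k Y (gen k φ a) =
      (PiTensorProduct.tprod k (evalWord φ a) : ⨂[k]^(Y.n + 1) A) := by
  refine (yonedaEval_mk k (symBar k A) φ _).trans ?_
  exact PiTensorProduct.lift.tprod (φ := barMultilinear k A φ) a

/-- Evaluation at `[0]`. -/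
def eval₀ : (tensorFunctor k (symBar k A)).obj (freeOp k (obj 0)) ≃ₗ[k] A :=
  (evalBar k (obj 0)).trans (tensorPowerOne k A)

/-- Evaluation at `[2]`. -/
def eval₂ : (tensorFunctor k (symBar k A)).obj (freeOp k (obj 2)) ≃ₗ[k] A ⊗[k] (A ⊗[k] A) :=
  (evalBar k (obj 2)).trans (tensorPowerThree k A)

/-- Evaluation at `[3]`. -/
def eval₃ : (tensorFunctor k (symBar k A)).obj (freeOp k (obj 3)) ≃ₗ[k]
    A ⊗[k] (A ⊗[k] (A ⊗[k] A)) :=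
  (evalBar k (obj 3)).trans (tensorPowerFour k A)

lemma eval₀_gen {X : DeltaS} (φ : X ⟶ obj 0) (a : Fin (X.n + 1) → A) :
    eval₀ k (gen k φ a) = evalWord φ a 0 := by
  refine (congrArg (tensorPowerOne k A) (evalBar_gen k φ a)).trans ?_
  exact tensorPowerOne_tprod k A _

lemma eval₂_gen {X : DeltaS} (φ : X ⟶ obj 2) (a : Fin (X.n + 1) → A) :
    eval₂ k (gen k φ a) = evalWord φ a 0 ⊗ₜ[k] (evalWord φ a 1 ⊗ₜ[k] evalWord φ a 2) := by
  refine (congrArg (tensorPowerThree k A) (evalBar_gen k φ a)).trans ?_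
  exact tensorPowerThree_tprod k A _

lemma eval₃_gen {X : DeltaS} (φ : X ⟶ obj 3) (a : Fin (X.n + 1) → A) :
    eval₃ k (gen k φ a) = evalWord φ a 0 ⊗ₜ[k]
      (evalWord φ a 1 ⊗ₜ[k] (evalWord φ a 2 ⊗ₜ[k] evalWord φ a 3)) := by
  refine (congrArg (tensorPowerFour k A) (evalBar_gen k φ a)).trans ?_
  exact tensorPowerFour_tprod k A _

lemma evalWord_id_comp_ofWords {n m : ℕ} (w : Fin (m + 1) → List (Fin (n + 1))) (hw)
    (a : Fin (n + 1) → A) (j : Fin (m + 1)) :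
    evalWord (X := obj n) (Y := obj m) (𝟙 (obj n) ≫ DeltaS.ofWords w hw) a j =
      ((w j).map a).prod := by
  rw [Category.id_comp]
  rfl

lemma evalWord_id {n : ℕ} (a : Fin (n + 1) → A) (j : Fin (n + 1)) :
    evalWord (𝟙 (obj n)) a j = a j := by
  change (([j] : List (Fin (n + 1))).map a).prod = a j
  simp

/-- Preimages of pure tensors are represented by identity morphisms. Hence the transported
differentials can be computed by reading off the words of the postcomposed morphisms. -/
lemma eval₀_symm (a : A) : (eval₀ k).symm a = gen k (𝟙 (obj 0)) ![a] := by
  rw [LinearEquiv.symm_apply_eq, eval₀_gen]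
  exact (evalWord_id (n := 0) ![a] 0).symm

lemma eval₂_symm (a b c : A) :
    (eval₂ k).symm (a ⊗ₜ[k] (b ⊗ₜ[k] c)) = gen k (𝟙 (obj 2)) ![a, b, c] := by
  rw [LinearEquiv.symm_apply_eq, eval₂_gen]
  erw [evalWord_id, evalWord_id, evalWord_id]
  rfl

lemma eval₃_symm (a b c d : A) :
    (eval₃ k).symm (a ⊗ₜ[k] (b ⊗ₜ[k] (c ⊗ₜ[k] d))) = gen k (𝟙 (obj 3)) ![a, b, c, d] := by
  rw [LinearEquiv.symm_apply_eq, eval₃_gen]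
  erw [evalWord_id, evalWord_id, evalWord_id, evalWord_id]
  rfl

/-- An additive functor to modules turns a biproduct into a product. -/
def mapBiprodEquiv {D : Type*} [Category D] [Preadditive D] (F : D ⥤ ModuleCat.{u} k) [F.Additive]
    (X Y : D) [HasBinaryBiproduct X Y] : F.obj (X ⊞ Y) ≃ₗ[k] F.obj X × F.obj Y :=
  LinearEquiv.ofLinearMap ((F.map biprod.fst).hom.prod (F.map biprod.snd).hom)
    ((F.map biprod.inl).hom.coprod (F.map biprod.inr).hom)
    (by
      have h : ∀ {V W Z : D} (f : V ⟶ W) (g : W ⟶ Z) (x : F.obj V),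
          (F.map g).hom ((F.map f).hom x) = (F.map (f ≫ g)).hom x := fun f g x => by simp
      refine LinearMap.ext fun ⟨x, y⟩ => Prod.ext ?_ ?_ <;>
      simp [h])
    (by
      have h : ∀ {V W Z : D} (f : V ⟶ W) (g : W ⟶ Z) (x : F.obj V),
          (F.map g).hom ((F.map f).hom x) = (F.map (f ≫ g)).hom x := fun f g x => by simp
      refine LinearMap.ext fun x => ?_
      have ht := congrArg (fun t => (F.map t).hom x) (biprod.total (X := X) (Y := Y))
      simp only [F.map_add, F.map_id, ModuleCat.hom_add, LinearMap.add_apply, ModuleCat.hom_id,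
        LinearMap.id_apply, ← h] at ht
      exact ht)

lemma mapBiprodEquiv_inl {D : Type*} [Category D] [Preadditive D] (F : D ⥤ ModuleCat.{u} k)
    [F.Additive] (X Y : D) [HasBinaryBiproduct X Y] (x : F.obj X) :
    mapBiprodEquiv k F X Y ((F.map biprod.inl).hom x) = (x, 0) := by
  rw [← LinearEquiv.eq_symm_apply]
  simp [mapBiprodEquiv]

lemma mapBiprodEquiv_inr {D : Type*} [Category D] [Preadditive D] (F : D ⥤ ModuleCat.{u} k)
    [F.Additive] (X Y : D) [HasBinaryBiproduct X Y] (y : F.obj Y) :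
    mapBiprodEquiv k F X Y ((F.map biprod.inr).hom y) = (0, y) := by
  rw [← LinearEquiv.eq_symm_apply]
  simp [mapBiprodEquiv]

end Evaluation

/-! ### Derived functors in degrees 0 and 1 from a partial projective resolution. -/

section PartialResolution

variable {D : Type*} [Category D] [Abelian D] [EnoughProjectives D]
  {Z P₀ P₁ P₂ : D} (ε : P₀ ⟶ Z) (d₀ : P₁ ⟶ P₀) (d₁ : P₂ ⟶ P₁) (w₁ : d₁ ≫ d₀ = 0)

/-- The next step of a projective resolution. -/
def nextSyzygies (S : ShortComplex D) : Σ' (X : D) (d : X ⟶ S.X₁), d ≫ S.f = 0 :=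
  ⟨Projective.syzygies S.f, Projective.d S.f,
    (Category.assoc _ _ _).trans ((congrArg _ (kernel.condition S.f)).trans comp_zero)⟩

/-- The extension of a partial projective resolution by syzygies. -/
def extendComplex : ChainComplex D ℕ :=
  ChainComplex.mk P₀ P₁ P₂ d₀ d₁ w₁ nextSyzygies

lemma extendComplex_d_one_zero : (extendComplex d₀ d₁ w₁).d 1 0 = d₀ :=
  ChainComplex.mk_d_1_0 ..

lemma extendComplex_d_two_one : (extendComplex d₀ d₁ w₁).d 2 1 = d₁ :=
  ChainComplex.mk_d_2_1 ..

lemma extendComplex_d_comp (w₀ : d₀ ≫ ε = 0) : (extendComplex d₀ d₁ w₁).d 1 0 ≫ ε = 0 :=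
  (congrArg (fun f : P₁ ⟶ P₀ => f ≫ ε) (extendComplex_d_one_zero d₀ d₁ w₁)).trans w₀

/-- In degree 1 this is the given exactness; in higher degrees each new term is a projective cover
of a kernel in the weak sense, i.e. a projective mapping onto it. -/
lemma extendComplex_exactAt_succ (h₁ : (ShortComplex.mk _ _ w₁).Exact) (n : ℕ) :
    (extendComplex d₀ d₁ w₁).ExactAt (n + 1) := by
  rw [HomologicalComplex.exactAt_iff' _ (n + 1 + 1) (n + 1) n (by simp) (by simp)]
  match n with
  | 0 =>
    refine (ShortComplex.exact_iff_of_iso ?_).2 h₁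
    exact ShortComplex.isoMk (Iso.refl _) (Iso.refl _) (Iso.refl _)
      ((Category.id_comp _).trans ((extendComplex_d_two_one d₀ d₁ w₁).symm.trans (Category.comp_id _).symm))
      ((Category.id_comp _).trans ((extendComplex_d_one_zero d₀ d₁ w₁).symm.trans (Category.comp_id _).symm))
  | n + 1 =>
    refine (ShortComplex.exact_iff_of_iso ?_).2
      (exact_d_f ((extendComplex d₀ d₁ w₁).d (n + 2) (n + 1)))
    exact ShortComplex.isoMk (ChainComplex.mkXIso P₀ P₁ P₂ d₀ d₁ w₁ nextSyzygies n) (Iso.refl _) (Iso.refl _)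
      ((ChainComplex.mk_d P₀ P₁ P₂ d₀ d₁ w₁ nextSyzygies n).symm.trans (Category.comp_id _).symm)
      ((Category.id_comp _).trans (Category.comp_id _).symm)

lemma extendComplex_projective [Projective P₀] [Projective P₁] [Projective P₂] (n : ℕ) :
    Projective ((extendComplex d₀ d₁ w₁).X n) := by
  obtain (_ | _ | _ | n) := n
  · assumption
  · assumption
  · assumption
  · apply Projective.projective_over

/-- A partial projective resolution extends to a projective resolution. -/
def extendResolution (w₀ : d₀ ≫ ε = 0) [Projective P₀] [Projective P₁] [Projective P₂] [Epi ε]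
    (h₀ : (ShortComplex.mk _ _ w₀).Exact) (h₁ : (ShortComplex.mk _ _ w₁).Exact) :
    ProjectiveResolution Z where
  complex := extendComplex d₀ d₁ w₁
  projective := extendComplex_projective d₀ d₁ w₁
  π := (ChainComplex.toSingle₀Equiv _ _).symm ⟨ε, extendComplex_d_comp ε d₀ d₁ w₁ w₀⟩
  quasiIso := ⟨fun n => by
    cases n
    · rw [ChainComplex.quasiIsoAt₀_iff, ShortComplex.quasiIso_iff_of_zeros']
      · refine (ShortComplex.exact_and_epi_g_iff_of_iso ?_).2 ⟨h₀, by dsimp; infer_instance⟩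
        exact ShortComplex.isoMk (Iso.refl _) (Iso.refl _) (Iso.refl _)
          ((Category.id_comp _).trans ((extendComplex_d_one_zero d₀ d₁ w₁).symm.trans (Category.comp_id _).symm))
          ((Category.id_comp _).trans ((ChainComplex.toSingle₀Equiv_symm_apply_f_zero (C := extendComplex d₀ d₁ w₁) ε
            (extendComplex_d_comp ε d₀ d₁ w₁ w₀)).symm.trans (Category.comp_id _).symm))
      all_goals rfl
    · rw [quasiIsoAt_iff_exactAt']
      · exact extendComplex_exactAt_succ d₀ d₁ w₁ h₁ _
      · apply ChainComplex.exactAt_succ_single_obj⟩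

variable {k : Type u} [CommRing k] (F : D ⥤ ModuleCat.{u} k) [F.Additive]

theorem leftDerived_zero_equiv (w₀ : d₀ ≫ ε = 0) [Projective P₀] [Projective P₁] [Projective P₂] [Epi ε]
    (h₀ : (ShortComplex.mk _ _ w₀).Exact) (h₁ : (ShortComplex.mk _ _ w₁).Exact) :
    Nonempty ((F.leftDerived 0).obj Z ≃ₗ[k] F.obj P₀ ⧸ LinearMap.range (F.map d₀).hom) := by
  let R := extendResolution ε d₀ d₁ w₁ w₀ h₀ h₁
  let K := (F.mapHomologicalComplex (ComplexShape.down ℕ)).obj R.complex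
  let S : ShortComplex (ModuleCat.{u} k) :=
    ShortComplex.mk (F.map d₀) (0 : F.obj P₀ ⟶ F.obj P₀) comp_zero
  have i : K.sc' 1 0 0 ≅ S := ShortComplex.isoMk (Iso.refl _) (Iso.refl _) (Iso.refl _)
      ((Category.id_comp _).trans ((congrArg F.map (extendComplex_d_one_zero d₀ d₁ w₁).symm).trans (Category.comp_id _).symm))
      -- Degree 0 has no successor in the complex, so the outgoing map is the zero map from degree 0
      -- to itself and homology is the cokernel of `F.map d₀`.
      ((Category.id_comp _).trans ((K.shape 0 0 (by simp)).symm.trans (Category.comp_id _).symm))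
  exact ⟨((R.isoLeftDerivedObj F 0).trans
    ((ShortComplex.homologyMapIso ((K.isoSc' 1 0 0 (by simp) (by simp)).trans i)).trans
      ((ShortComplex.asIsoHomologyι S rfl).trans S.moduleCatOpcyclesIso))).toLinearEquiv⟩

/-- Degree 1 homology involves only the terms in degrees 2, 1, 0, so the chosen continuation by
syzygies does not enter the answer. -/
theorem leftDerived_one_equiv (w₀ : d₀ ≫ ε = 0) [Projective P₀] [Projective P₁] [Projective P₂] [Epi ε]
    (h₀ : (ShortComplex.mk _ _ w₀).Exact) (h₁ : (ShortComplex.mk _ _ w₁).Exact) :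
    Nonempty ((F.leftDerived 1).obj Z ≃ₗ[k] homologyAt (F.map d₁).hom (F.map d₀).hom) := by
  let R := extendResolution ε d₀ d₁ w₁ w₀ h₀ h₁
  let K := (F.mapHomologicalComplex (ComplexShape.down ℕ)).obj R.complex
  let S : ShortComplex (ModuleCat.{u} k) :=
    ShortComplex.mk (F.map d₁) (F.map d₀) (by rw [← F.map_comp, w₁, F.map_zero])
  have i : K.sc' 2 1 0 ≅ S := ShortComplex.isoMk (Iso.refl _) (Iso.refl _) (Iso.refl _)
      ((Category.id_comp _).trans ((congrArg F.map (extendComplex_d_two_one d₀ d₁ w₁).symm).trans (Category.comp_id _).symm))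
      ((Category.id_comp _).trans ((congrArg F.map (extendComplex_d_one_zero d₀ d₁ w₁).symm).trans (Category.comp_id _).symm))
  have e : (LinearMap.ker S.g.hom ⧸ LinearMap.range S.moduleCatToCycles) ≃ₗ[k]
      homologyAt S.f.hom S.g.hom := Submodule.quotEquivOfEq _ _ (by
    ext ⟨x, hx⟩
    simp only [LinearMap.mem_range, Submodule.submoduleOf, Submodule.mem_comap,
      Submodule.subtype_apply]
    exact exists_congr fun y => Subtype.ext_iff)
  exact ⟨((R.isoLeftDerivedObj F 1).trans
    ((ShortComplex.homologyMapIso ((K.isoSc' 2 1 0 (by simp) (by simp)).trans i)).trans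
      S.moduleCatHomologyIso)).toLinearEquiv.trans e⟩

end PartialResolution

/-! ### Invariance of cokernels and homology under isomorphism. -/

section Homology

variable {k : Type u} [CommRing k]

/-- The cokernel is invariant under isomorphisms of linear maps. -/
lemma quotient_range_equiv {M N M' N' : Type u} [AddCommGroup M] [AddCommGroup N]
    [AddCommGroup M'] [AddCommGroup N'] [Module k M] [Module k N] [Module k M'] [Module k N']
    (f : M →ₗ[k] N) (f' : M' →ₗ[k] N') (e : M ≃ₗ[k] M') (e' : N ≃ₗ[k] N')
    (h : ∀ x, e' (f x) = f' (e x)) :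
    Nonempty ((N ⧸ LinearMap.range f) ≃ₗ[k] N' ⧸ LinearMap.range f') := by
  refine ⟨Submodule.Quotient.equiv _ _ e' ?_⟩
  ext y
  simp only [Submodule.mem_map, LinearMap.mem_range]
  constructor
  · rintro ⟨_, ⟨x, rfl⟩, rfl⟩
    exact ⟨e x, (h x).symm⟩
  · rintro ⟨x, rfl⟩
    exact ⟨_, ⟨e.symm x, rfl⟩, by simp [h]⟩

/-- Homology is invariant under isomorphisms of complexes. -/
lemma homologyAt_equiv {M N P M' N' P' : Type u} [AddCommGroup M] [AddCommGroup N]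
    [AddCommGroup P] [AddCommGroup M'] [AddCommGroup N'] [AddCommGroup P'] [Module k M]
    [Module k N] [Module k P] [Module k M'] [Module k N'] [Module k P']
    (f : M →ₗ[k] N) (g : N →ₗ[k] P) (f' : M' →ₗ[k] N') (g' : N' →ₗ[k] P')
    (e₂ : M ≃ₗ[k] M') (e₁ : N ≃ₗ[k] N') (e₀ : P ≃ₗ[k] P')
    (hf : ∀ x, e₁ (f x) = f' (e₂ x)) (hg : ∀ x, e₀ (g x) = g' (e₁ x)) :
    Nonempty (homologyAt f g ≃ₗ[k] homologyAt f' g') := by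
  have hk : (LinearMap.ker g).map (e₁ : N →ₗ[k] N') = LinearMap.ker g' := by
    ext y
    simp only [Submodule.mem_map, LinearMap.mem_ker, LinearEquiv.coe_coe]
    constructor
    · rintro ⟨x, hx, rfl⟩
      rw [← hg, hx, map_zero]
    · intro hy
      refine ⟨e₁.symm y, e₀.injective ?_, by simp⟩
      rw [hg, e₁.apply_symm_apply, hy, map_zero]
  refine ⟨Submodule.Quotient.equiv _ _ (e₁.ofSubmodules _ _ hk) ?_⟩
  ext ⟨y, hy⟩
  simp only [Submodule.mem_map, Submodule.submoduleOf, Submodule.mem_comap,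
    Submodule.subtype_apply, LinearMap.mem_range]
  constructor
  · rintro ⟨⟨_, _⟩, ⟨x, rfl⟩, h⟩
    exact ⟨e₂ x, (hf x).symm.trans (congrArg Subtype.val h)⟩
  · rintro ⟨x, rfl⟩
    have hx : g (f (e₂.symm x)) = 0 := e₀.injective (by
      rw [hg, hf, e₂.apply_symm_apply, map_zero]
      exact hy)
    exact ⟨⟨f (e₂.symm x), hx⟩, ⟨_, rfl⟩, Subtype.ext (by simp [hf])⟩

end Homology

/-! ### The explicit complex and symmetric homology. -/

section Complex

variable (k : Type u) [CommRing k] (A : Type u) [Ring A] [Algebra k A]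

/-- Evaluation on the last term of the partial resolution. -/
def evalLast : (tensorFunctor k (symBar k A)).obj (freeOp k (obj 3) ⊞ freeOp k (obj 0)) ≃ₗ[k]
    (A ⊗[k] (A ⊗[k] (A ⊗[k] A))) × A :=
  (mapBiprodEquiv k (tensorFunctor k (symBar k A)) _ _).trans
    (LinearEquiv.prodCongr (eval₃ k) (eval₀ k))

lemma evalLast_inl (x) :
    evalLast k A (((tensorFunctor k (symBar k A)).map biprod.inl).hom x) = (eval₃ k x, 0) := by
  rw [evalLast, LinearEquiv.trans_apply, mapBiprodEquiv_inl]
  simp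

lemma evalLast_inr (x) :
    evalLast k A (((tensorFunctor k (symBar k A)).map biprod.inr).hom x) = (0, eval₀ k x) := by
  rw [evalLast, LinearEquiv.trans_apply, mapBiprodEquiv_inr]
  simp

/-- The differential `a ⊗ b ⊗ c ↦ abc - cba`. -/
def boundary₁ : A ⊗[k] (A ⊗[k] A) →ₗ[k] A :=
  (eval₀ k).toLinearMap ∘ₗ ((tensorFunctor k (symBar k A)).map (rho k)).hom ∘ₗ
    (eval₂ k).symm.toLinearMap

/-- The differential `A^{⊗4} ⊕ A → A^{⊗3}`. -/
def boundary₂ : (A ⊗[k] (A ⊗[k] (A ⊗[k] A))) × A →ₗ[k] A ⊗[k] (A ⊗[k] A) :=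
  (eval₂ k).toLinearMap ∘ₗ
    ((tensorFunctor k (symBar k A)).map (biprod.desc (alpha k) (beta k))).hom ∘ₗ
      (evalLast k A).symm.toLinearMap

/-- The differentials are defined by transport along the evaluations, so compatibility with them is
automatic; the content lies in the explicit formulas below. -/
lemma boundary₁_eval (z) : eval₀ k (((tensorFunctor k (symBar k A)).map (rho k)).hom z) =
    boundary₁ k A (eval₂ k z) := by
  simp [boundary₁]

lemma boundary₂_evalLast (z) :
    eval₂ k (((tensorFunctor k (symBar k A)).map (biprod.desc (alpha k) (beta k))).hom z) =
      boundary₂ k A (evalLast k A z) := by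
  simp [boundary₂]

lemma boundary₁_tmul (a b c : A) :
    boundary₁ k A (a ⊗ₜ[k] (b ⊗ₜ[k] c)) = a * b * c - c * b * a := by
  have h := (boundary₁_eval k A ((eval₂ k).symm (a ⊗ₜ[k] (b ⊗ₜ[k] c)))).symm
  rw [LinearEquiv.apply_symm_apply, eval₂_symm, rho, Functor.map_sub, ModuleCat.hom_sub,
    LinearMap.sub_apply, tensorFunctor_map_gen, tensorFunctor_map_gen, map_sub, eval₀_gen,
    eval₀_gen, evalWord_id_comp_ofWords, evalWord_id_comp_ofWords] at h
  refine h.trans ?_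
  simp [mul_assoc]

lemma boundary₂_inl (a b c d : A) : boundary₂ k A (a ⊗ₜ[k] (b ⊗ₜ[k] (c ⊗ₜ[k] d)), 0) =
    (a * b) ⊗ₜ[k] (c ⊗ₜ[k] d) + d ⊗ₜ[k] ((c * a) ⊗ₜ[k] b) +
      (b * c * a) ⊗ₜ[k] ((1 : A) ⊗ₜ[k] d) + d ⊗ₜ[k] ((b * c) ⊗ₜ[k] a) := by
  have h := (boundary₂_evalLast k A (((tensorFunctor k (symBar k A)).map biprod.inl).hom
    ((eval₃ k).symm (a ⊗ₜ[k] (b ⊗ₜ[k] (c ⊗ₜ[k] d)))))).symm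
  rw [evalLast_inl, LinearEquiv.apply_symm_apply, ← LinearMap.comp_apply, ← ModuleCat.hom_comp,
    ← Functor.map_comp, biprod.inl_desc, eval₃_symm, alpha] at h
  simp only [Functor.map_add, ModuleCat.hom_add, LinearMap.add_apply, tensorFunctor_map_gen,
    map_add, eval₂_gen, evalWord_id_comp_ofWords] at h
  refine h.trans ?_
  simp [mul_assoc]

lemma boundary₂_inr (a : A) :
    boundary₂ k A (0, a) = (1 : A) ⊗ₜ[k] (a ⊗ₜ[k] (1 : A)) := by
  have h := (boundary₂_evalLast k A (((tensorFunctor k (symBar k A)).map biprod.inr).hom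
    ((eval₀ k).symm a))).symm
  rw [evalLast_inr, LinearEquiv.apply_symm_apply, ← LinearMap.comp_apply, ← ModuleCat.hom_comp,
    ← Functor.map_comp, biprod.inr_desc, eval₀_symm, beta, tensorFunctor_map_gen, eval₂_gen,
    evalWord_id_comp_ofWords, evalWord_id_comp_ofWords, evalWord_id_comp_ofWords] at h
  refine h.trans ?_
  simp

/-- No computation in A is needed: the identity is the image of `desc_comp_rho` under the tensor
functor. -/
lemma boundary_comp : boundary₁ k A ∘ₗ boundary₂ k A = 0 := by
  refine LinearMap.ext fun x => ?_
  obtain ⟨z, rfl⟩ := (evalLast k A).surjective x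
  rw [LinearMap.comp_apply, ← boundary₂_evalLast, ← boundary₁_eval, ← LinearMap.comp_apply,
    ← ModuleCat.hom_comp, ← Functor.map_comp, desc_comp_rho, Functor.map_zero]
  simp

theorem HS_zero_equiv : Nonempty (HS k A 0 ≃ₗ[k] A ⧸ LinearMap.range (boundary₁ k A)) := by
  have := freeOp_projective k (obj 0)
  have := freeOp_projective k (obj 2)
  have := freeOp_projective k (obj 3)
  obtain ⟨e⟩ := leftDerived_zero_equiv _ _ _ (desc_comp_rho k)
    (tensorFunctor k (symBar k A)) (rho_comp_augmentation k) (rho_exact k) (desc_exact k)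
  obtain ⟨e'⟩ := quotient_range_equiv _ (boundary₁ k A) (eval₂ k) (eval₀ k) (boundary₁_eval k A)
  exact ⟨e.trans e'⟩

theorem HS_one_equiv : Nonempty (HS k A 1 ≃ₗ[k] homologyAt (boundary₂ k A) (boundary₁ k A)) := by
  have := freeOp_projective k (obj 0)
  have := freeOp_projective k (obj 2)
  have := freeOp_projective k (obj 3)
  obtain ⟨e⟩ := leftDerived_one_equiv _ _ _ (desc_comp_rho k)
    (tensorFunctor k (symBar k A)) (rho_comp_augmentation k) (rho_exact k) (desc_exact k)
  obtain ⟨e'⟩ := homologyAt_equiv _ _ (boundary₂ k A) (boundary₁ k A) (evalLast k A) (eval₂ k)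
    (eval₀ k) (boundary₂_evalLast k A) (boundary₁_eval k A)
  exact ⟨e.trans e'⟩

end Complex

end SymmetricHomology

end

open SymmetricHomology in
theorem mainTheorem7 (k : Type u) [CommRing k] (A : Type u) [Ring A] [Algebra k A] :
    -- The partial projective resolution of the trivial module.
    (Projective (freeOp k (obj 0)) ∧ Projective (freeOp k (obj 2)) ∧
      Projective (freeOp k (obj 3) ⊞ freeOp k (obj 0)) ∧
      Epi (augmentation k (obj 0)) ∧
      (∃ w : rho k ≫ augmentation k (obj 0) = 0, (ShortComplex.mk _ _ w).Exact) ∧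
      (∃ w : biprod.desc (alpha k) (beta k) ≫ rho k = 0, (ShortComplex.mk _ _ w).Exact)) ∧
    -- The partial chain complex.
    ∃ (d₁ : A ⊗[k] (A ⊗[k] A) →ₗ[k] A)
      (d₂ : (A ⊗[k] (A ⊗[k] (A ⊗[k] A))) × A →ₗ[k] A ⊗[k] (A ⊗[k] A)),
      (∀ a b c : A, d₁ (a ⊗ₜ[k] (b ⊗ₜ[k] c)) = a * b * c - c * b * a) ∧
      (∀ a b c d : A, d₂ (a ⊗ₜ[k] (b ⊗ₜ[k] (c ⊗ₜ[k] d)), 0) =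
        (a * b) ⊗ₜ[k] (c ⊗ₜ[k] d) + d ⊗ₜ[k] ((c * a) ⊗ₜ[k] b) +
          (b * c * a) ⊗ₜ[k] ((1 : A) ⊗ₜ[k] d) + d ⊗ₜ[k] ((b * c) ⊗ₜ[k] a)) ∧
      (∀ a : A, d₂ (0, a) = (1 : A) ⊗ₜ[k] (a ⊗ₜ[k] (1 : A))) ∧
      d₁ ∘ₗ d₂ = 0 ∧
      -- Its homology is symmetric homology in degrees 0 and 1.
      Nonempty (HS k A 0 ≃ₗ[k] A ⧸ LinearMap.range d₁) ∧
      Nonempty (HS k A 1 ≃ₗ[k] homologyAt d₂ d₁) ∧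
      -- Evaluation identifies it with the resolution tensored with the symmetric bar construction.
      ∃ (e₀ : (tensorFunctor k (symBar k A)).obj (freeOp k (obj 0)) ≃ₗ[k] A)
        (e₁ : (tensorFunctor k (symBar k A)).obj (freeOp k (obj 2)) ≃ₗ[k] A ⊗[k] (A ⊗[k] A))
        (e₂ : (tensorFunctor k (symBar k A)).obj (freeOp k (obj 3) ⊞ freeOp k (obj 0)) ≃ₗ[k]
          (A ⊗[k] (A ⊗[k] (A ⊗[k] A))) × A),
        (∀ (X : DeltaS) (φ : X ⟶ obj 0) (a : Fin (X.n + 1) → A),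
          e₀ (gen k φ a) = evalWord φ a 0) ∧
        (∀ (X : DeltaS) (φ : X ⟶ obj 2) (a : Fin (X.n + 1) → A),
          e₁ (gen k φ a) = evalWord φ a 0 ⊗ₜ[k] (evalWord φ a 1 ⊗ₜ[k] evalWord φ a 2)) ∧
        (∀ (X : DeltaS) (φ : X ⟶ obj 3) (a : Fin (X.n + 1) → A),
          e₂ (((tensorFunctor k (symBar k A)).map biprod.inl).hom (gen k φ a)) =
            (evalWord φ a 0 ⊗ₜ[k] (evalWord φ a 1 ⊗ₜ[k] (evalWord φ a 2 ⊗ₜ[k] evalWord φ a 3)), 0)) ∧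
        (∀ (X : DeltaS) (φ : X ⟶ obj 0) (a : Fin (X.n + 1) → A),
          e₂ (((tensorFunctor k (symBar k A)).map biprod.inr).hom (gen k φ a)) =
            (0, evalWord φ a 0)) ∧
        (∀ z, e₀ (((tensorFunctor k (symBar k A)).map (rho k)).hom z) = d₁ (e₁ z)) ∧
        (∀ z, e₁ (((tensorFunctor k (symBar k A)).map
          (biprod.desc (alpha k) (beta k))).hom z) = d₂ (e₂ z)) := by
  have := freeOp_projective k (obj 0)
  have := freeOp_projective k (obj 2)
  have := freeOp_projective k (obj 3)
  refine ⟨⟨inferInstance, inferInstance, inferInstance, inferInstance,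
    ⟨rho_comp_augmentation k, rho_exact k⟩, ⟨desc_comp_rho k, desc_exact k⟩⟩,
    boundary₁ k A, boundary₂ k A, boundary₁_tmul k A, boundary₂_inl k A, boundary₂_inr k A,
    boundary_comp k A, HS_zero_equiv k A, HS_one_equiv k A, eval₀ k, eval₂ k, evalLast k A,
    fun X φ a => eval₀_gen k φ a, fun X φ a => eval₂_gen k φ a, fun X φ a => ?_,
    fun X φ a => ?_, boundary₁_eval k A, boundary₂_evalLast k A⟩
  · rw [evalLast_inl, eval₃_gen]
  · rw [evalLast_inr, eval₀_gen]
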